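/- Let $g>0$ be the gravitational acceleration. There are $n$ follower quad-rotors $i=1,\dots,n$ with position $p_i=(x_i,y_i,z_i)$ and roll, pitch and yaw angles $\phi_i,\theta_i,\psi_i$, modelled for $t\ge 0$ (rigid body, virtual inputs $u_{i,1},\dots,u_{i,4}$) by $$\ddot x_i=u_{i,1}(\cos\psi_i\sin\theta_i\cos\phi_i+\sin\psi_i\sin\phi_i),\quad \ddot y_i=u_{i,1}(\sin\psi_i\sin\theta_i\cos\phi_i-\cos\psi_i\sin\phi_i),\quad \ddot z_i=u_{i,1}\cos\theta_i\cos\phi_i-g,$$ $$\ddot\phi_i=u_{i,2},\qquad \ddot\theta_i=u_{i,3},\qquad \ddot\psi_i=u_{i,4}.$$ The leader is $p_0(t)=(x_0(t),y_0(t),z_0)$, where $x_0,y_0$ are four times differentiable on $[0,\infty)$ with bounded derivatives of orders $1,\dots,4$, and $z_0$ is constant. The interaction graph on the followers is undirected and connected, with adjacency weights $a_{ij}\in\{0,1\}$; $a_{i0}=1$ if follower $i$ is informed by the leader and $a_{i0}=0$ otherwise, and at least one $a_{i0}$ is $1$. Let $\Delta_i=(d_{i,x},d_{i,y},d_{i,z})\in\mathbb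 R^3$ be constant. For quantities $v_1,\dots,v_n,v_0$ write $\delta_i(v)=\sum_{j=1}^n a_{ij}(v_i-v_j)+a_{i0}(v_i-v_0)$. **Observers.** Each follower runs an observer with output $p_{id}=(x_{id},y_{id},z_{id})$. For $w=x$ and for $w=y$, with $w_{id}$ the corresponding coordinate, $$w_{id}^{(4)}=-g_3w_{id}^{(3)}-g_2\ddot w_{id}-g_1\dot w_{id}-g_4c_{i,w}-\frac{g_{5,w}\,c_{i,w}}{|c_{i,w}|+\gamma e^{-\lambda t}},\qquad c_{i,w}=\delta_i(w^{(3)})+g_3\delta_i(\ddot w)+g_2\delta_i(\dot w)+g_1\delta_i(w),$$ where in $\delta_i$ the follower values are those of the observers $w_{jd}$ and the value with index $0$ is that of the leader; and $$\ddot z_{id}=-h_1\tanh(\dot z_{id}+h_2(z_{id}-z_{ia}))-h_3\tanh\dot z_{id},\qquad \ddot z_{ia}=-h_4(z_{ia}-z_{ib})-h_5\dot z_{ia},\qquad \dot z_{ib}=-h_6\Big(\sum_{j}a_{ij}(z_{ib}-z_{jb})+a_{i0}(z_{ib}-z_0)\Big).$$ The gains satisfy $g_2,g_3,g_4,\gamma,\lambda>0$,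 $g_2g_3>g_1>0$, $g_{5,w}\ge\sup_{t\ge0}|w_0^{(4)}+g_3w_0^{(3)}+g_2\ddot w_0+g_1\dot w_0|$ for $w=x,y$, $h_1,\dots,h_6>0$ and $h_1+h_3<g$. **Local tracking laws.** Put $e_{i,x}=x_i-x_{id}-d_{i,x}$, $e_{i,y}=y_i-y_{id}-d_{i,y}$, $e_{i,z}=z_i-z_{id}-d_{i,z}$. Let $$u_{i,4}=-k_{1,\psi}\psi_i-k_{2,\psi}\dot\psi_i,\qquad u_{i,1}=\frac{\bar u_{i,1}}{\cos\theta_i\cos\phi_i},\qquad \bar u_{i,1}=g+\ddot z_{id}-k_{1,z}\tanh(\dot e_{i,z}+k_{2,z}e_{i,z})-k_{3,z}\tanh\dot e_{i,z},$$ $$\begin{bmatrix}u_{i,2}\\u_{i,3}\end{bmatrix}=\frac{M_i^{-1}S^{-1}R_2(\psi_i)^{-1}}{\bar u_{i,1}}\left\{\begin{bmatrix}x_{id}^{(4)}\\y_{id}^{(4)}\end{bmatrix}-\Xi_{i,2}+\begin{bmatrix}u_{i,x}\\u_{i,y}\end{bmatrix}\right\},\qquad u_{i,w}=-k_{1,w}e_{i,w}-k_{2,w}\dot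 e_{i,w}-k_{3,w}\ddot e_{i,w}-k_{4,w}e_{i,w}^{(3)}\quad(w=x,y),$$ where $$R_2(\psi)=\begin{bmatrix}\cos\psi&-\sin\psi\\ \sin\psi&\cos\psi\end{bmatrix},\quad S=\begin{bmatrix}1&0\\0&-1\end{bmatrix},\quad M_i=\begin{bmatrix}0&\sec^2\theta_i\\ \sec^2\phi_i\sec\theta_i&\tan\phi_i\tan\theta_i\sec\theta_i\end{bmatrix},$$ $$\Xi_{i,1}=\Big[\dot{\bar u}_{i,1}R_2(\psi_i)+\bar u_{i,1}\tfrac{d R_2(\psi_i)}{dt}\Big]S\begin{bmatrix}\tan\theta_i\\ \tan\phi_i/\cos\theta_i\end{bmatrix},$$ $$\Xi_{i,2}=\dot\Xi_{i,1}+\Big[\dot{\bar u}_{i,1}R_2(\psi_i)SM_i+\bar u_{i,1}\tfrac{dR_2(\psi_i)}{dt}SM_i+\bar u_{i,1}R_2(\psi_i)S\tfrac{dM_i}{dt}\Big]\begin{bmatrix}\dot\phi_i\\ \dot\theta_i\end{bmatrix},$$ all time derivatives of $\bar u_{i,1}$, $R_2(\psi_i)$, $M_i$ and $\Xi_{i,1}$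 being written out by the chain rule along the motion (the derivatives of $(\tan\theta_i,\tan\phi_i/\cos\theta_i)^T$ being $M_i(\dot\phi_i,\dot\theta_i)^T$). The gains satisfy $k_{1,\psi},k_{2,\psi},k_{1,z},k_{2,z},k_{3,z}>0$; $k_{1,z}+k_{3,z}<g-|\ddot z_{id}(t)|$ for all $i$ and all $t\ge0$; and for $w=x,y$ the linear system $e^{(4)}=-k_{1,w}e-k_{2,w}\dot e-k_{3,w}\ddot e-k_{4,w}e^{(3)}$ is exponentially stable (all roots of $s^4+k_{4,w}s^3+k_{3,w}s^2+k_{2,w}s+k_{1,w}$ have negative real part). **Theorem.** For every solution on $[0,\infty)$ of the resulting closed loop of followers and observers with $\phi_i(0),\theta_i(0)\in(-\pi/2,\pi/2)$ for all $i$ (all other initial values being arbitrary), $$\lim_{t\to\infty}\big(p_i(t)-p_0(t)\big)=\Delta_i\qquad\text{for every } i=1,\dots,n.$$ -/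

import Mathlib

open Set Filter Topology Matrix

namespace QuadrotorFormation

noncomputable section

/-! ### Time derivatives on the half line `[0, ∞)` -/

/-- The `k`-th time derivative at time `t` of a signal on `[0, ∞)` (one-sided at `t = 0`). -/
def D (k : ℕ) (f : ℝ → ℝ) (t : ℝ) : ℝ := iteratedDerivWithin k f (Ici 0) t

/-- The signal `f` is `k` times differentiable on `[0, ∞)`. -/
def TimesDiff (k : ℕ) (f : ℝ → ℝ) : Prop :=
  ∀ j < k, DifferentiableOn ℝ (D j f) (Ici 0)

/-! ### Quad-rotors, leader, interaction graph, gains -/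

/-- The position and attitude signals of one quad-rotor: position `(x, y, z)` in the inertial frame,
roll `φ`, pitch `θ`, yaw `ψ`. -/
structure Quad where
  x : ℝ → ℝ
  y : ℝ → ℝ
  z : ℝ → ℝ
  φ : ℝ → ℝ
  θ : ℝ → ℝ
  ψ : ℝ → ℝ

/-- The rigid-body quad-rotor model with gravitational acceleration `g` and the virtual inputs
`u₁` (thrust per mass), `u₂`, `u₃`, `u₄` (angular accelerations). -/
structure IsModelTrajectory (g : ℝ) (q : Quad) (u₁ u₂ u₃ u₄ : ℝ → ℝ) : Prop where
  diff_x : TimesDiff 2 q.x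
  diff_y : TimesDiff 2 q.y
  diff_z : TimesDiff 2 q.z
  diff_φ : TimesDiff 2 q.φ
  diff_θ : TimesDiff 2 q.θ
  diff_ψ : TimesDiff 2 q.ψ
  eq_x : ∀ t, 0 ≤ t → D 2 q.x t =
    u₁ t * (Real.cos (q.ψ t) * Real.sin (q.θ t) * Real.cos (q.φ t)
      + Real.sin (q.ψ t) * Real.sin (q.φ t))
  eq_y : ∀ t, 0 ≤ t → D 2 q.y t =
    u₁ t * (Real.sin (q.ψ t) * Real.sin (q.θ t) * Real.cos (q.φ t)
      - Real.cos (q.ψ t) * Real.sin (q.φ t))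
  eq_z : ∀ t, 0 ≤ t → D 2 q.z t = u₁ t * Real.cos (q.θ t) * Real.cos (q.φ t) - g
  eq_φ : ∀ t, 0 ≤ t → D 2 q.φ t = u₂ t
  eq_θ : ∀ t, 0 ≤ t → D 2 q.θ t = u₃ t
  eq_ψ : ∀ t, 0 ≤ t → D 2 q.ψ t = u₄ t

/-- The leader: horizontal signals `x`, `y` and a constant altitude `z`. -/
structure Leader where
  x : ℝ → ℝ
  y : ℝ → ℝ
  z : ℝ

/-- A leader coordinate is four times differentiable on `[0, ∞)`, and its derivatives of
orders 1 to 4 are bounded there (the coordinate itself need not be bounded). -/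
def SmoothBounded (f : ℝ → ℝ) : Prop :=
  TimesDiff 4 f ∧ ∀ k, 1 ≤ k → k ≤ 4 → ∃ C : ℝ, ∀ t, 0 ≤ t → |D k f t| ≤ C

/-- The weight `a_{i0}` of the information flow from the leader to follower `i`. -/
def leaderWeight {n : ℕ} (informed : Finset (Fin n)) (i : Fin n) : ℝ :=
  if i ∈ informed then 1 else 0

/-- The gains of the local tracking laws and of the distributed observers. -/
structure Gains where
  (kψ₁ kψ₂ : ℝ)
  (kz₁ kz₂ kz₃ : ℝ)
  (kx₁ kx₂ kx₃ kx₄ : ℝ)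
  (ky₁ ky₂ ky₃ ky₄ : ℝ)
  (g₁ g₂ g₃ g₄ g₅x g₅y γ lam : ℝ)
  (h₁ h₂ h₃ h₄ h₅ h₆ : ℝ)

/-- Exponential stability of `e⁗ = - k₁ e - k₂ e' - k₃ e'' - k₄ e'''`: all characteristic roots
lie in the open left half plane. -/
def ExpStable (k₁ k₂ k₃ k₄ : ℝ) : Prop :=
  ∀ s : ℂ, s ^ 4 + k₄ * s ^ 3 + k₃ * s ^ 2 + k₂ * s + k₁ = 0 → s.re < 0

/-- The selection rules for the gains that do not refer to the closed loop. -/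
structure Gains.Admissible (K : Gains) (g : ℝ) (L : Leader) : Prop where
  kψ₁_pos : 0 < K.kψ₁
  kψ₂_pos : 0 < K.kψ₂
  kz₁_pos : 0 < K.kz₁
  kz₂_pos : 0 < K.kz₂
  kz₃_pos : 0 < K.kz₃
  stable_x : ExpStable K.kx₁ K.kx₂ K.kx₃ K.kx₄
  stable_y : ExpStable K.ky₁ K.ky₂ K.ky₃ K.ky₄
  g₁_pos : 0 < K.g₁
  g₂_pos : 0 < K.g₂
  g₃_pos : 0 < K.g₃
  g₁_lt : K.g₁ < K.g₂ * K.g₃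
  g₄_pos : 0 < K.g₄
  γ_pos : 0 < K.γ
  lam_pos : 0 < K.lam
  g₅x_ge : ∀ t, 0 ≤ t → |D 4 L.x t + K.g₃ * D 3 L.x t + K.g₂ * D 2 L.x t + K.g₁ * D 1 L.x t| ≤ K.g₅x
  g₅y_ge : ∀ t, 0 ≤ t → |D 4 L.y t + K.g₃ * D 3 L.y t + K.g₂ * D 2 L.y t + K.g₁ * D 1 L.y t| ≤ K.g₅y
  h₁_pos : 0 < K.h₁
  h₂_pos : 0 < K.h₂
  h₃_pos : 0 < K.h₃
  h₄_pos : 0 < K.h₄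
  h₅_pos : 0 < K.h₅
  h₆_pos : 0 < K.h₆
  h_lt : K.h₁ + K.h₃ < g

/-! ### Distributed observers -/

/-- The observer signals of one follower: the virtual reference trajectory `(x, y, z)` and the
auxiliary altitude signals `za`, `zb`. -/
structure Obs where
  x : ℝ → ℝ
  y : ℝ → ℝ
  z : ℝ → ℝ
  za : ℝ → ℝ
  zb : ℝ → ℝ

section Observer

variable {n : ℕ} (G : SimpleGraph (Fin n)) [DecidableRel G.Adj] (informed : Finset (Fin n))

/-- `∑ⱼ aᵢⱼ (vᵢ - vⱼ) + aᵢ₀ (vᵢ - v₀)`, the disagreement of follower `i` with its neighbours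
(and with the leader, if `i` is informed). -/
def disagreement (v : Fin n → ℝ) (v₀ : ℝ) (i : Fin n) : ℝ :=
  ∑ j, G.adjMatrix ℝ i j * (v i - v j) + leaderWeight informed i * (v i - v₀)

/-- One coordinate of the combined disagreement `c_i` of the horizontal observer,
where `w j` is that coordinate of the observer of follower `j` and `w₀` that of the leader. -/
def cTerm (K : Gains) (w : Fin n → ℝ → ℝ) (w₀ : ℝ → ℝ) (i : Fin n) (t : ℝ) : ℝ :=
  disagreement G informed (fun j => D 3 (w j) t) (D 3 w₀ t) i
    + K.g₃ * disagreement G informed (fun j => D 2 (w j) t) (D 2 w₀ t) i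
    + K.g₂ * disagreement G informed (fun j => D 1 (w j) t) (D 1 w₀ t) i
    + K.g₁ * disagreement G informed (fun j => w j t) (w₀ t) i

/-- One coordinate of the fourth-order horizontal observer. -/
def IsHorizontalObserver (K : Gains) (g₅ : ℝ) (w : Fin n → ℝ → ℝ) (w₀ : ℝ → ℝ) : Prop :=
  ∀ i, TimesDiff 4 (w i) ∧ ∀ t, 0 ≤ t →
    D 4 (w i) t = - K.g₃ * D 3 (w i) t - K.g₂ * D 2 (w i) t - K.g₁ * D 1 (w i) t
      - K.g₄ * cTerm G informed K w w₀ i t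
      - g₅ / (|cTerm G informed K w w₀ i t| + K.γ * Real.exp (- K.lam * t))
          * cTerm G informed K w w₀ i t

/-- The distributed observers of all followers, driven by the leader. -/
structure IsObserver (K : Gains) (L : Leader) (o : Fin n → Obs) : Prop where
  eq_x : IsHorizontalObserver G informed K K.g₅x (fun i => (o i).x) L.x
  eq_y : IsHorizontalObserver G informed K K.g₅y (fun i => (o i).y) L.y
  diff_z : ∀ i, TimesDiff 2 (o i).z
  diff_za : ∀ i, TimesDiff 2 (o i).za
  diff_zb : ∀ i, TimesDiff 1 (o i).zb
  eq_z : ∀ i t, 0 ≤ t → D 2 (o i).z t =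
    - K.h₁ * Real.tanh (D 1 (o i).z t + K.h₂ * ((o i).z t - (o i).za t))
      - K.h₃ * Real.tanh (D 1 (o i).z t)
  eq_za : ∀ i t, 0 ≤ t → D 2 (o i).za t =
    - K.h₄ * ((o i).za t - (o i).zb t) - K.h₅ * D 1 (o i).za t
  eq_zb : ∀ i t, 0 ≤ t → D 1 (o i).zb t =
    - K.h₆ * disagreement G informed (fun j => (o j).zb t) L.z i

end Observer

/-! ### The local tracking law of one follower

`q` is the quad-rotor, `o` its observer (reference trajectory), `d = (d_x, d_y, d_z)` its
desired displacement from the leader. -/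

section Local

variable (g : ℝ) (K : Gains) (q : Quad) (o : Obs) (d : Fin 3 → ℝ)

/-- Tracking errors. -/
def ex (t : ℝ) : ℝ := q.x t - o.x t - d 0
def ey (t : ℝ) : ℝ := q.y t - o.y t - d 1
def ez (t : ℝ) : ℝ := q.z t - o.z t - d 2

/-- The intermediate thrust variable `ū₁`. -/
def ubar (t : ℝ) : ℝ :=
  g + D 2 o.z t - K.kz₁ * Real.tanh (D 1 (ez q o d) t + K.kz₂ * ez q o d t)
    - K.kz₃ * Real.tanh (D 1 (ez q o d) t)

/-- The thrust law. -/
def u₁ (t : ℝ) : ℝ := 1 / (Real.cos (q.θ t) * Real.cos (q.φ t)) * ubar g K q o d t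

/-- The yaw law. -/
def u₄ (t : ℝ) : ℝ := - K.kψ₁ * q.ψ t - K.kψ₂ * D 1 q.ψ t

/-- `1 - tanh²` at the two arguments that occur in `ū₁`. -/
def sech2a (t : ℝ) : ℝ := 1 - Real.tanh (D 1 (ez q o d) t + K.kz₂ * ez q o d t) ^ 2
def sech2b (t : ℝ) : ℝ := 1 - Real.tanh (D 1 (ez q o d) t) ^ 2

/-- The third derivative of the altitude error, in terms of lower ones. -/
def ez3 (t : ℝ) : ℝ :=
  - K.kz₁ * sech2a K q o d t * (D 2 (ez q o d) t + K.kz₂ * D 1 (ez q o d) t)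
    - K.kz₃ * sech2b q o d t * D 2 (ez q o d) t

/-- The first derivative of `ū₁`. -/
def ubar' (t : ℝ) : ℝ :=
  D 3 o.z t - K.kz₃ * sech2b q o d t * D 2 (ez q o d) t
    - K.kz₁ * sech2a K q o d t * (D 2 (ez q o d) t + K.kz₂ * D 1 (ez q o d) t)

/-- The second derivative of `ū₁`. -/
def ubar'' (t : ℝ) : ℝ :=
  D 4 o.z t
    + 2 * K.kz₁ * sech2a K q o d t * (D 2 (ez q o d) t + K.kz₂ * D 1 (ez q o d) t) ^ 2
        * Real.tanh (D 1 (ez q o d) t + K.kz₂ * ez q o d t)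
    - K.kz₁ * sech2a K q o d t * (ez3 K q o d t + K.kz₂ * D 2 (ez q o d) t)
    + 2 * K.kz₃ * sech2b q o d t * D 2 (ez q o d) t ^ 2 * Real.tanh (D 1 (ez q o d) t)
    - K.kz₃ * sech2b q o d t * ez3 K q o d t

/-- The planar rotation matrix. -/
def R₂ (α : ℝ) : Matrix (Fin 2) (Fin 2) ℝ :=
  !![Real.cos α, - Real.sin α; Real.sin α, Real.cos α]

def S : Matrix (Fin 2) (Fin 2) ℝ := !![1, 0; 0, -1]

/-- First and second time derivative of `R₂(ψ)`. -/
def R₂' (t : ℝ) : Matrix (Fin 2) (Fin 2) ℝ :=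
  D 1 q.ψ t • (R₂ (Real.pi / 2) * R₂ (q.ψ t))
def R₂'' (t : ℝ) : Matrix (Fin 2) (Fin 2) ℝ :=
  D 2 q.ψ t • (R₂ (Real.pi / 2) * R₂ (q.ψ t))
    + D 1 q.ψ t ^ 2 • (R₂ (Real.pi / 2) ^ 2 * R₂ (q.ψ t))

/-- The secant. -/
def sec (α : ℝ) : ℝ := 1 / Real.cos α

/-- The vector `(tan θ, tan φ / cos θ)`. -/
def tanVec (t : ℝ) : Fin 2 → ℝ :=
  ![Real.tan (q.θ t), Real.tan (q.φ t) / Real.cos (q.θ t)]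

/-- The vector `(φ', θ')`. -/
def rates (t : ℝ) : Fin 2 → ℝ := ![D 1 q.φ t, D 1 q.θ t]

/-- The matrix `M`, for which `tanVec' = M (φ', θ')`. -/
def M (t : ℝ) : Matrix (Fin 2) (Fin 2) ℝ :=
  !![0, sec (q.θ t) ^ 2;
    sec (q.φ t) ^ 2 * sec (q.θ t), Real.tan (q.φ t) * Real.tan (q.θ t) * sec (q.θ t)]

/-- The time derivative of `M`. -/
def M' (t : ℝ) : Matrix (Fin 2) (Fin 2) ℝ :=
  !![0, 2 * D 1 q.θ t * sec (q.θ t) ^ 2 * Real.tan (q.θ t);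
    2 * D 1 q.φ t * sec (q.φ t) ^ 2 * Real.tan (q.φ t) * sec (q.θ t)
      + D 1 q.θ t * sec (q.φ t) ^ 2 * Real.tan (q.θ t) * sec (q.θ t),
    D 1 q.φ t * sec (q.φ t) ^ 2 * Real.tan (q.θ t) * sec (q.θ t)
      + D 1 q.θ t * Real.tan (q.φ t)
          * (sec (q.θ t) ^ 3 + Real.tan (q.θ t) ^ 2 * sec (q.θ t))]

/-- The time derivative of `Ξ₁ = (ū₁' R₂ + ū₁ R₂') S tanVec`. -/
def Ξ₁' (t : ℝ) : Fin 2 → ℝ :=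
  ((ubar'' K q o d t • R₂ (q.ψ t) + (2 * ubar' K q o d t) • R₂' q t
      + ubar g K q o d t • R₂'' q t) * S) *ᵥ tanVec q t
    + ((ubar' K q o d t • R₂ (q.ψ t) + ubar g K q o d t • R₂' q t) * S * M q t) *ᵥ rates q t

/-- The drift term `Ξ₂` of the fourth-order error dynamics. -/
def Ξ₂ (t : ℝ) : Fin 2 → ℝ :=
  Ξ₁' g K q o d t
    + (ubar' K q o d t • (R₂ (q.ψ t) * S * M q t)
        + ubar g K q o d t • (R₂' q t * S * M q t)
        + ubar g K q o d t • (R₂ (q.ψ t) * S * M' q t)) *ᵥ rates q t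

/-- The linear laws `u_x`, `u_y`. -/
def ux (t : ℝ) : ℝ :=
  - K.kx₁ * ex q o d t - K.kx₂ * D 1 (ex q o d) t - K.kx₃ * D 2 (ex q o d) t
    - K.kx₄ * D 3 (ex q o d) t
def uy (t : ℝ) : ℝ :=
  - K.ky₁ * ey q o d t - K.ky₂ * D 1 (ey q o d) t - K.ky₃ * D 2 (ey q o d) t
    - K.ky₄ * D 3 (ey q o d) t

/-- The feedback-linearizing law for `(u₂, u₃)`. -/
def u₂₃ (t : ℝ) : Fin 2 → ℝ :=
  (1 / ubar g K q o d t) • (((M q t)⁻¹ * S⁻¹ * (R₂ (q.ψ t))⁻¹) *ᵥ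
    (![D 4 o.x t, D 4 o.y t] - Ξ₂ g K q o d t + ![ux K q o d t, uy K q o d t]))

/-- The quad-rotor `q` under the local tracking law driven by its observer `o`. -/
def IsControlled : Prop :=
  IsModelTrajectory g q (u₁ g K q o d) (fun t => u₂₃ g K q o d t 0)
    (fun t => u₂₃ g K q o d t 1) (u₄ K q)

end Local

end

end QuadrotorFormation

/-! The closed loop is a cascade: observer errors vanish, tracking errors vanish, and `p_i - p_0 -
Δ_i` is their sum.

Horizontal observers. With `e = w_i - w_0`, the combination `s = e''' + g₃ e'' + g₂ e' + g₁ e` obeys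
a first-order networked equation driven by its own disagreement `c`. Connectedness and an informed
follower make the form `∑ s_i c_i` positive definite. Along solutions it satisfies `Q' ≤ -κ Q + C
exp(-λ t)`, because the `g₅` term dominates the leader's drift up to a residue of size `γ exp(-λ t)`
(`expDecayOn_consensus`). Routh-Hurwitz and `expDecayOn_of_stable` carry the decay from `s` to `e`.

Altitude. `z_b` reaches consensus exponentially, `z_a` is a stable linear filter of `z_b`, and `z_d`
is a saturated double integrator with decaying input, handled by a log-cosh Lyapunov function and a
Barbalat argument (`tendsto_zero_of_saturated`). The altitude tracking error is the same saturated
system with zero input.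

Horizontal tracking. While `cos θ cos φ ≠ 0`, the attitude law cancels the nonlinear drift exactly,
and the errors solve stable linear fourth-order equations (`horizontal_error_dynamics`). The crux is
that the singularity is never reached (`cos_ne_zero_of_isControlled`). Before a hypothetical first
singular time `T`, linear stability bounds the error accelerations; the reference accelerations are
bounded and `ū₁` is bounded below on the compact `[0, T]`. Hence `tan θ` and `tan φ / cos θ` are
bounded on `[0, T)`, which contradicts `cos θ cos φ = 0` at `T`. For this reason the linear theory
is developed on an initial interval `J`: it is used first on `[0, T)`, then on `[0, ∞)`. -/

namespace QuadrotorFormation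

/-- An interval that starts at `0` and is relatively open in `[0, ∞)`. -/
structure IsInitialInterval (J : Set ℝ) : Prop where
  convex : Convex ℝ J
  zero_mem : (0 : ℝ) ∈ J
  subset : J ⊆ Ici 0
  mem_nhds : ∀ t ∈ J, J ∈ 𝓝[Ici 0] t

lemma isInitialInterval_Ici : IsInitialInterval (Ici (0 : ℝ)) :=
  ⟨convex_Ici 0, mem_Ici.2 le_rfl, subset_rfl, fun _ _ => self_mem_nhdsWithin⟩

lemma isInitialInterval_Ico {T : ℝ} (hT : 0 < T) : IsInitialInterval (Ico 0 T) :=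
  ⟨convex_Ico 0 T, left_mem_Ico.2 hT, fun _ ht => ht.1, fun _ ht =>
    mem_of_superset (inter_mem_nhdsWithin (Ici 0) (Iio_mem_nhds ht.2)) fun _ hs => ⟨hs.1, hs.2⟩⟩

/-- Exponential decay on the time set `J`. -/
def ExpDecayOn {E : Type*} [Norm E] (J : Set ℝ) (f : ℝ → E) : Prop :=
  ∃ C μ : ℝ, 0 < μ ∧ ∀ t ∈ J, ‖f t‖ ≤ C * Real.exp (-μ * t)

/-! ### Calculus of exponentially decaying signals. -/

section Decay

variable {E : Type*} [NormedAddCommGroup E] {J : Set ℝ} {f h : ℝ → E}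

lemma ExpDecayOn.congr (hf : ExpDecayOn J f) (hfh : EqOn h f J) : ExpDecayOn J h := by
  obtain ⟨C, μ, hμ, hC⟩ := hf
  exact ⟨C, μ, hμ, fun t ht => by rw [hfh ht]; exact hC t ht⟩

lemma ExpDecayOn.of_norm_le {F : Type*} [NormedAddCommGroup F] {k : ℝ → F} (hf : ExpDecayOn J f)
    (hk : ∀ t ∈ J, ‖k t‖ ≤ ‖f t‖) : ExpDecayOn J k := by
  obtain ⟨C, μ, hμ, hC⟩ := hf
  exact ⟨C, μ, hμ, fun t ht => (hk t ht).trans (hC t ht)⟩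

lemma ExpDecayOn.exists_common (hJ : J ⊆ Ici 0) (hf : ExpDecayOn J f) :
    ∃ C μ : ℝ, 0 < μ ∧ 0 ≤ C ∧ ∀ ν ≤ μ, ∀ t ∈ J, ‖f t‖ ≤ C * Real.exp (-ν * t) := by
  obtain ⟨C, μ, hμ, hC⟩ := hf
  refine ⟨|C|, μ, hμ, abs_nonneg C, fun ν hν t ht => (hC t ht).trans ?_⟩
  have h0 : 0 ≤ t := hJ ht
  have h1 : Real.exp (-μ * t) ≤ Real.exp (-ν * t) := Real.exp_le_exp.2 (by nlinarith)
  calc C * Real.exp (-μ * t) ≤ |C| * Real.exp (-μ * t) := by gcongr; exact le_abs_self C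
    _ ≤ _ := by gcongr

lemma ExpDecayOn.add (hJ : J ⊆ Ici 0) (hf : ExpDecayOn J f) (hh : ExpDecayOn J h) :
    ExpDecayOn J (fun t => f t + h t) := by
  obtain ⟨C, μ, hμ, -, hC⟩ := hf.exists_common hJ
  obtain ⟨C', μ', hμ', -, hC'⟩ := hh.exists_common hJ
  refine ⟨C + C', min μ μ', lt_min hμ hμ', fun t ht => (norm_add_le _ _).trans ?_⟩
  rw [add_mul]
  exact add_le_add (hC _ (min_le_left _ _) t ht) (hC' _ (min_le_right _ _) t ht)

lemma ExpDecayOn.smul {𝕜 : Type*} [NormedField 𝕜] [NormedSpace 𝕜 E] (c : 𝕜)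
    (hf : ExpDecayOn J f) : ExpDecayOn J (fun t => c • f t) := by
  obtain ⟨C, μ, hμ, hC⟩ := hf
  refine ⟨‖c‖ * C, μ, hμ, fun t ht => ?_⟩
  rw [norm_smul, mul_assoc]
  exact mul_le_mul_of_nonneg_left (hC t ht) (norm_nonneg c)

lemma expDecayOn_zero : ExpDecayOn J (fun _ => (0 : E)) :=
  ⟨0, 1, one_pos, fun t _ => by simp⟩

lemma ExpDecayOn.tendsto_zero (hf : ExpDecayOn (Ici 0) f) : Tendsto f atTop (𝓝 0) := by
  obtain ⟨C, μ, hμ, hC⟩ := hf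
  refine squeeze_zero_norm' (a := fun t => C * Real.exp (-μ * t)) ?_ ?_
  · filter_upwards [eventually_ge_atTop 0] with t ht using hC t ht
  · have h1 : Tendsto (fun t : ℝ => -μ * t) atTop atBot :=
      tendsto_id.const_mul_atTop_of_neg (neg_lt_zero.2 hμ)
    simpa using (Real.tendsto_exp_atBot.comp h1).const_mul C

lemma ExpDecayOn.bounded (hJ : J ⊆ Ici 0) (hf : ExpDecayOn J f) : ∃ C, ∀ t ∈ J, ‖f t‖ ≤ C := by
  obtain ⟨C, μ, hμ, -, hC⟩ := hf.exists_common hJ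
  exact ⟨C, fun t ht => by simpa using hC 0 hμ.le t ht⟩

lemma ExpDecayOn.of_sq_norm (hf : ExpDecayOn J (fun t => ‖f t‖ ^ 2)) : ExpDecayOn J f := by
  obtain ⟨C, μ, hμ, hC⟩ := hf
  refine ⟨√C, μ / 2, by positivity, fun t ht => ?_⟩
  have h1 : ‖f t‖ ^ 2 ≤ C * Real.exp (-μ * t) := by simpa using hC t ht
  have h2 : Real.exp (-(μ / 2) * t) = √(Real.exp (-μ * t)) := by
    rw [Real.sqrt_eq_rpow, ← Real.exp_mul]; ring_nf
  rw [h2, ← Real.sqrt_mul' _ (Real.exp_pos _).le]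
  exact Real.le_sqrt_of_sq_le h1

end Decay

/-! ### Comparison principle and scalar first-order equations. -/

section Comparison

variable {J : Set ℝ}

lemma antitoneOn_of_deriv_nonpos_right (hJ : Convex ℝ J) (hJ0 : J ⊆ Ici 0) {U U' : ℝ → ℝ}
    (hU : ∀ t ∈ J, HasDerivWithinAt U (U' t) (Ici 0) t) (hU' : ∀ t ∈ J, U' t ≤ 0) :
    AntitoneOn U J :=
  antitoneOn_of_hasDerivWithinAt_nonpos hJ (fun t ht => ((hU t ht).mono hJ0).continuousWithinAt)
    (fun t ht => (hU t (interior_subset ht)).mono (interior_subset.trans hJ0))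
    fun t ht => hU' t (interior_subset ht)

lemma hasDerivWithinAt_exp_mul (a t : ℝ) (s : Set ℝ) :
    HasDerivWithinAt (fun t => Real.exp (a * t)) (a * Real.exp (a * t)) s t := by
  have := ((hasDerivAt_id t).const_mul a).exp.hasDerivWithinAt (s := s)
  simpa [mul_comm] using this

/-- The comparison principle for `V' ≤ -κ V + C exp(-lam t)`. -/
lemma expDecayOn_of_deriv_le (hJ : IsInitialInterval J) {V V' : ℝ → ℝ} {κ C lam : ℝ} (hκ : 0 < κ)
    (hlam : 0 < lam) (hV : ∀ t ∈ J, HasDerivWithinAt V (V' t) (Ici 0) t)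
    (hV0 : ∀ t ∈ J, 0 ≤ V t) (hC : 0 ≤ C)
    (hle : ∀ t ∈ J, V' t ≤ -κ * V t + C * Real.exp (-lam * t)) : ExpDecayOn J V := by
  -- `μ ≤ κ` lets the damping absorb the derivative of the integrating factor `exp (μ t)`. The
  -- strict `μ < lam` keeps the weighted forcing integrable; its tail integral is the second summand
  -- of `U` below.
  obtain ⟨μ, hμ, hμκ, hμl⟩ : ∃ μ, 0 < μ ∧ μ ≤ κ ∧ μ < lam :=
    ⟨min κ lam / 2, by positivity, by linarith [min_le_left κ lam, lt_min hκ hlam],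
      by linarith [min_le_right κ lam, lt_min hκ hlam]⟩
  have hd : 0 < lam - μ := by linarith
  have hanti := antitoneOn_of_deriv_nonpos_right hJ.convex hJ.subset
    (U := fun t => V t * Real.exp (μ * t) + C / (lam - μ) * Real.exp ((μ - lam) * t))
    (U' := fun t => V' t * Real.exp (μ * t) + V t * (μ * Real.exp (μ * t))
      + C / (lam - μ) * ((μ - lam) * Real.exp ((μ - lam) * t)))
    (fun t ht => ((hV t ht).mul (hasDerivWithinAt_exp_mul μ t _)).add
      ((hasDerivWithinAt_exp_mul (μ - lam) t _).const_mul _))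
    (fun t ht => by
      have e1 : Real.exp ((μ - lam) * t) = Real.exp (-lam * t) * Real.exp (μ * t) := by
        rw [← Real.exp_add]; ring_nf
      have e2 : C / (lam - μ) * ((μ - lam) * Real.exp ((μ - lam) * t))
          = -(C * Real.exp (-lam * t) * Real.exp (μ * t)) := by
        rw [e1]; field_simp; ring
      rw [e2]
      have h1 := hle t ht
      have h2 : μ * V t ≤ κ * V t := mul_le_mul_of_nonneg_right hμκ (hV0 t ht)
      have h3 := Real.exp_pos (μ * t)
      nlinarith [mul_le_mul_of_nonneg_right (show V' t + μ * V t ≤ C * Real.exp (-lam * t) by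
        linarith) h3.le])
  refine ⟨V 0 + C / (lam - μ), μ, hμ, fun t ht => ?_⟩
  have h := hanti hJ.zero_mem ht (hJ.subset ht)
  simp only [mul_zero, Real.exp_zero, mul_one] at h
  have h1 : V t * Real.exp (μ * t) ≤ V 0 + C / (lam - μ) := by
    have : 0 ≤ C / (lam - μ) * Real.exp ((μ - lam) * t) := by positivity
    linarith
  rw [Real.norm_of_nonneg (hV0 t ht), neg_mul, Real.exp_neg, ← div_eq_mul_inv,
    le_div_iff₀ (Real.exp_pos _)]
  exact h1

/-- A stable first-order complex system driven by an exponentially decaying input. -/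
lemma expDecayOn_of_firstOrder (hJ : IsInitialInterval J) {r : ℂ} (hr : r.re < 0)
    {u f : ℝ → ℂ} (hu : ∀ t ∈ J, HasDerivWithinAt u (r * u t + f t) (Ici 0) t)
    (hf : ExpDecayOn J f) : ExpDecayOn J u := by
  obtain ⟨C, μ, hμ, hC⟩ := hf
  have hre : ∀ t ∈ J, HasDerivWithinAt (fun t => (u t).re) ((r * u t + f t).re) (Ici 0) t :=
    fun t ht => Complex.reCLM.hasFDerivAt.comp_hasDerivWithinAt t (hu t ht)
  have him : ∀ t ∈ J, HasDerivWithinAt (fun t => (u t).im) ((r * u t + f t).im) (Ici 0) t :=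
    fun t ht => Complex.imCLM.hasFDerivAt.comp_hasDerivWithinAt t (hu t ht)
  refine ExpDecayOn.of_sq_norm ?_
  -- The square `‖u‖²` has damping rate `-2 r.re`. Young's inequality spends half of it on the cross
  -- term with `f`, which leaves the rate `-r.re` and the forcing `‖f‖² / (-r.re)`.
  refine expDecayOn_of_deriv_le hJ (κ := -r.re) (C := C ^ 2 / (-r.re)) (lam := 2 * μ)
    (V' := fun t => 2 * (u t).re * (r * u t + f t).re + 2 * (u t).im * (r * u t + f t).im)
    (by linarith) (by linarith) (fun t ht => ?_) (fun t _ => by positivity)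
    (div_nonneg (sq_nonneg _) (by linarith)) fun t ht => ?_
  · have h := ((hre t ht).pow 2).add ((him t ht).pow 2)
    refine (h.congr_deriv (by simp)).congr (fun s _ => ?_) ?_ <;>
    · simp only [Pi.add_apply, Pi.pow_apply, Complex.sq_norm, Complex.normSq_apply]; ring
  · have e : C ^ 2 / (-r.re) * Real.exp (-(2 * μ) * t)
        = (C * Real.exp (-μ * t)) ^ 2 / (-r.re) := by
      rw [mul_pow, ← Real.exp_nat_mul]; push_cast; ring_nf
    rw [e, Complex.sq_norm, Complex.normSq_apply]
    have hfC : (f t).re ^ 2 + (f t).im ^ 2 ≤ (C * Real.exp (-μ * t)) ^ 2 := by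
      have := pow_le_pow_left₀ (norm_nonneg _) (hC t ht) 2
      rw [Complex.sq_norm, Complex.normSq_apply] at this; linarith
    set B := (C * Real.exp (-μ * t)) ^ 2
    have ha : 0 < -r.re := by linarith
    have hB : ∀ w v : ℝ, 2 * (w * v) ≤ -r.re * w ^ 2 + v ^ 2 / (-r.re) := fun w v => by
      have := div_nonneg (sq_nonneg (-r.re * w - v)) ha.le
      have e2 : (-r.re * w - v) ^ 2 / (-r.re) = -r.re * w ^ 2 - 2 * (w * v) + v ^ 2 / (-r.re) := by
        rw [sub_sq, add_div, sub_div, pow_two (-r.re * w)]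
        congr 2
        · field_simp
        · rw [div_eq_iff ha.ne']; ring
      linarith
    have h1 := hB (u t).re (f t).re
    have h2 := hB (u t).im (f t).im
    have h3 := div_le_div_of_nonneg_right hfC ha.le
    rw [add_div] at h3
    simp only [Complex.add_re, Complex.add_im, Complex.mul_re, Complex.mul_im]
    nlinarith

end Comparison

/-! ### Stable linear equations of arbitrary order and Hurwitz polynomials. -/

section LinearSystems

open Polynomial

variable {J : Set ℝ}

/-- The shift of a sequence of signals. -/
noncomputable def shift : Module.End ℂ (ℕ → ℝ → ℂ) := LinearMap.funLeft ℂ (ℝ → ℂ) Nat.succ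

lemma shift_pow_apply (k j : ℕ) (Y : ℕ → ℝ → ℂ) : (shift ^ k) Y j = Y (j + k) := by
  induction k generalizing j with
  | zero => simp
  | succ k ih =>
    rw [pow_succ', Module.End.mul_apply]
    change (shift ^ k) Y (j + 1) = _
    rw [ih]; congr 1; omega

/-- On a chain of derivatives `shift` acts as `d/dt`, so a polynomial in `shift` is a differential
operator, and factoring it needs no further smoothness. One factor is peeled off: `Z = Y' - r Y` is
a chain for the remaining roots and decays by induction. Then `Y 0` solves a stable first-order
equation with input `Z 0`, and `Y (j + 1) = Z j + r Y j` gives the higher orders. -/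
lemma expDecayOn_of_prod_roots (hJ : IsInitialInterval J) (s : Multiset ℂ)
    (hs : ∀ r ∈ s, r.re < 0) : ∀ Y : ℕ → ℝ → ℂ,
    (∀ j < s.card, ∀ t ∈ J, HasDerivWithinAt (Y j) (Y (j + 1) t) (Ici 0) t) →
    ExpDecayOn J (aeval shift (s.map fun r => X - C r).prod Y 0) →
    ∀ j ≤ s.card, ExpDecayOn J (Y j) := by
  induction s using Multiset.induction_on with
  | empty =>
    intro Y _ hf j hj
    obtain rfl : j = 0 := by simpa using hj
    simpa using hf
  | cons r s ih =>
    intro Y hY hf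
    set Z : ℕ → ℝ → ℂ := fun j t => Y (j + 1) t - r * Y j t with hZ
    have hZY : aeval shift (X - C r) Y = Z := by
      ext j t
      simp [shift, hZ, LinearMap.funLeft_apply, Module.algebraMap_end_apply]
    have hZd : ∀ j ≤ s.card, ExpDecayOn J (Z j) := by
      refine ih (fun r hr => hs r (Multiset.mem_cons_of_mem hr)) Z (fun j hj t ht => ?_) ?_
      · have h1 := hY j (by rw [Multiset.card_cons]; omega) t ht
        have h2 := hY (j + 1) (by rw [Multiset.card_cons]; omega) t ht
        exact h2.sub (h1.const_mul r)
      · rw [Multiset.map_cons, Multiset.prod_cons, mul_comm, map_mul, Module.End.mul_apply,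
          hZY] at hf
        exact hf
    have hY0 : ExpDecayOn J (Y 0) := by
      refine expDecayOn_of_firstOrder hJ (hs r (Multiset.mem_cons_self r s)) (f := Z 0)
        (fun t ht => ?_) (hZd 0 (Nat.zero_le _))
      refine (hY 0 (by simp) t ht).congr_deriv ?_
      simp [hZ]
    intro j
    induction j with
    | zero => exact fun _ => hY0
    | succ j ihj =>
      intro hj
      rw [Multiset.card_cons] at hj
      refine ((hZd j (by omega)).add hJ.subset ((ihj (by rw [Multiset.card_cons]; omega)).smul
        r)).congr fun t _ => ?_
      simp [hZ]

/-- A stable linear differential equation of order `n` driven by an exponentially decaying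
input. -/
lemma expDecayOn_of_stable (hJ : IsInitialInterval J) (n : ℕ) (a : ℕ → ℝ)
    (hroots : ∀ s : ℂ, s ^ n + ∑ k ∈ Finset.range n, (a k : ℂ) * s ^ k = 0 → s.re < 0)
    {y : ℕ → ℝ → ℝ}
    (hy : ∀ j < n, ∀ t ∈ J, HasDerivWithinAt (y j) (y (j + 1) t) (Ici 0) t)
    (hf : ExpDecayOn J (fun t => y n t + ∑ k ∈ Finset.range n, a k * y k t)) :
    ∀ j ≤ n, ExpDecayOn J (y j) := by
  set P : ℂ[X] := X ^ n + ∑ k ∈ Finset.range n, C (a k : ℂ) * X ^ k with hP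
  have hdeg : (∑ k ∈ Finset.range n, C (a k : ℂ) * X ^ k).degree < (n : WithBot ℕ) := by
    refine (degree_sum_le _ _).trans_lt ((Finset.sup_lt_iff (WithBot.bot_lt_coe n)).2 ?_)
    intro k hk
    exact (degree_C_mul_X_pow_le k _).trans_lt
      (WithBot.coe_lt_coe.2 (Finset.mem_range.1 hk))
  have hmonic : P.Monic := monic_X_pow_add hdeg
  have hnat : P.natDegree = n := by
    rw [hP, natDegree_eq_of_degree_eq_some]
    rw [degree_add_eq_left_of_degree_lt] <;> simp [hdeg]
  have hsplit := IsAlgClosed.splits P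
  have hprod : P = (P.roots.map fun r => X - C r).prod := hsplit.eq_prod_roots_of_monic hmonic
  have hcard : P.roots.card = n := by rw [← hnat]; exact hsplit.natDegree_eq_card_roots.symm
  have key := expDecayOn_of_prod_roots hJ P.roots (fun r hr => hroots r ?_)
    (fun j t => (y j t : ℂ)) (fun j hj t ht => (hy j (hcard ▸ hj) t ht).ofReal_comp) ?_
  · intro j hj
    exact (key j (hcard.symm ▸ hj)).of_norm_le fun _ _ => by simp
  · have := isRoot_of_mem_roots hr
    simpa [hP, IsRoot, eval_finsetSum] using this
  · rw [← hprod]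
    refine hf.of_norm_le fun t _ => le_of_eq ?_
    rw [← Complex.norm_real]
    congr 1
    simp [hP, LinearMap.sum_apply, Module.algebraMap_end_apply, shift_pow_apply,
      Finset.sum_apply]

lemma re_neg_of_quadratic {a b : ℝ} (ha : 0 < a) (hb : 0 < b) {s : ℂ}
    (hs : s ^ 2 + a * s + b = 0) : s.re < 0 := by
  by_contra! h
  have hre := congrArg Complex.re hs
  have him := congrArg Complex.im hs
  simp [pow_two] at hre him
  rcases eq_or_ne s.im 0 with h0 | h0
  · rw [h0] at hre; nlinarith [mul_nonneg ha.le h, mul_nonneg h h]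
  · have : 2 * s.re + a = 0 := mul_left_cancel₀ h0 (by linarith)
    linarith

/-- The Routh-Hurwitz criterion in degree three. -/
lemma re_neg_of_cubic {a b c : ℝ} (ha : 0 < a) (hb : 0 < b) (hc : 0 < c) (hcab : c < b * a) {s : ℂ}
    (hs : s ^ 3 + a * s ^ 2 + b * s + c = 0) : s.re < 0 := by
  by_contra! h
  have hre := congrArg Complex.re hs
  have him := congrArg Complex.im hs
  simp [pow_succ] at hre him
  rcases eq_or_ne s.im 0 with h0 | h0
  · rw [h0] at hre
    nlinarith [mul_nonneg hb.le h, mul_nonneg ha.le (mul_nonneg h h),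
      mul_nonneg (mul_nonneg h h) h]
  -- For a non-real root the imaginary part determines `s.im ^ 2`. Substituted into the real part,
  -- it leaves `-8 x³ - 8 a x² - 2 (a² + b) x + (c - a b) = 0` with `x = s.re`, impossible for `x ≥
  -- 0` since `c < b a`.
  · have e : s.im ^ 2 = 3 * s.re ^ 2 + 2 * a * s.re + b := by
      have : s.im * (3 * s.re ^ 2 + 2 * a * s.re + b - s.im ^ 2) = s.im * 0 := by linarith
      linarith [mul_left_cancel₀ h0 this]
    have e2 : s.re ^ 3 - 3 * s.re * s.im ^ 2 + a * (s.re ^ 2 - s.im ^ 2) + b * s.re + c = 0 := by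
      linarith
    rw [e] at e2
    nlinarith [mul_nonneg hb.le h, mul_nonneg ha.le (mul_nonneg h h),
      mul_nonneg (mul_nonneg h h) h, mul_nonneg (mul_nonneg ha.le ha.le) h]

end LinearSystems

/-! ### Positive definiteness of the disagreement form and robust consensus. -/

section Consensus

variable {n : ℕ} (G : SimpleGraph (Fin n)) [DecidableRel G.Adj] (informed : Finset (Fin n))

lemma disagreement_eq_sub (v : Fin n → ℝ) (v₀ : ℝ) (i : Fin n) :
    disagreement G informed v v₀ i = disagreement G informed (fun j => v j - v₀) 0 i := by
  simp [disagreement]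

/-- The symmetric bilinear form of the disagreement operator. -/
lemma sum_mul_disagreement (r s : Fin n → ℝ) :
    ∑ i, r i * disagreement G informed s 0 i =
      (∑ i, ∑ j, G.adjMatrix ℝ i j * ((s i - s j) * (r i - r j))) / 2
        + ∑ i, leaderWeight informed i * (s i * r i) := by
  have h1 : ∑ i, r i * disagreement G informed s 0 i =
      ∑ i, ∑ j, G.adjMatrix ℝ i j * (r i * (s i - s j))
        + ∑ i, leaderWeight informed i * (s i * r i) := by
    rw [← Finset.sum_add_distrib]
    refine Finset.sum_congr rfl fun i _ => ?_
    rw [disagreement, mul_add, Finset.mul_sum]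
    congr 1
    · exact Finset.sum_congr rfl fun j _ => by ring
    · ring
  have h2 : ∑ i, ∑ j, G.adjMatrix ℝ i j * (r i * (s i - s j)) =
      ∑ i, ∑ j, G.adjMatrix ℝ i j * (r j * (s j - s i)) := by
    rw [Finset.sum_comm]
    refine Finset.sum_congr rfl fun i _ => Finset.sum_congr rfl fun j _ => ?_
    simp only [SimpleGraph.adjMatrix_apply, G.adj_comm]
  have h3 : ∑ i, ∑ j, G.adjMatrix ℝ i j * ((s i - s j) * (r i - r j)) =
      ∑ i, ∑ j, G.adjMatrix ℝ i j * (r i * (s i - s j))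
        + ∑ i, ∑ j, G.adjMatrix ℝ i j * (r j * (s j - s i)) := by
    simp only [← Finset.sum_add_distrib]
    exact Finset.sum_congr rfl fun i _ => Finset.sum_congr rfl fun j _ => by ring
  rw [h1, h3, ← h2]; ring

lemma sum_mul_disagreement_comm (r s : Fin n → ℝ) :
    ∑ i, r i * disagreement G informed s 0 i = ∑ i, s i * disagreement G informed r 0 i := by
  simp only [sum_mul_disagreement, mul_comm]

lemma leaderWeight_nonneg (i : Fin n) : 0 ≤ leaderWeight informed i := by
  unfold leaderWeight; split_ifs <;> norm_num

lemma adjMatrix_nonneg (i j : Fin n) : 0 ≤ G.adjMatrix ℝ i j := by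
  rw [SimpleGraph.adjMatrix_apply]; split_ifs <;> norm_num

lemma sum_edges_nonneg (s : Fin n → ℝ) :
    0 ≤ ∑ i, ∑ j, G.adjMatrix ℝ i j * ((s i - s j) * (s i - s j)) :=
  Finset.sum_nonneg fun i _ => Finset.sum_nonneg fun j _ =>
    mul_nonneg (adjMatrix_nonneg G i j) (mul_self_nonneg _)

lemma sum_leaderWeight_nonneg (s : Fin n → ℝ) :
    0 ≤ ∑ i, leaderWeight informed i * (s i * s i) :=
  Finset.sum_nonneg fun i _ => mul_nonneg (leaderWeight_nonneg informed i) (mul_self_nonneg _)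

lemma sum_mul_disagreement_self_nonneg (s : Fin n → ℝ) :
    0 ≤ ∑ i, s i * disagreement G informed s 0 i := by
  rw [sum_mul_disagreement]
  linarith [sum_edges_nonneg G s, sum_leaderWeight_nonneg informed s]

variable {G informed}

lemma sq_sub_le_of_adj {i j : Fin n} (hij : G.Adj i j) (s : Fin n → ℝ) :
    (s i - s j) ^ 2 ≤ 2 * ∑ i, s i * disagreement G informed s 0 i := by
  have h1 : (s i - s j) ^ 2 ≤ ∑ i, ∑ j, G.adjMatrix ℝ i j * ((s i - s j) * (s i - s j)) := by
    calc (s i - s j) ^ 2 = G.adjMatrix ℝ i j * ((s i - s j) * (s i - s j)) := by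
          rw [SimpleGraph.adjMatrix_apply, if_pos hij]; ring
      _ ≤ ∑ j, G.adjMatrix ℝ i j * ((s i - s j) * (s i - s j)) :=
          Finset.single_le_sum (f := fun j => G.adjMatrix ℝ i j * ((s i - s j) * (s i - s j)))
            (fun j _ => mul_nonneg (adjMatrix_nonneg G i j) (mul_self_nonneg _))
            (Finset.mem_univ j)
      _ ≤ _ := Finset.single_le_sum
          (f := fun i => ∑ j, G.adjMatrix ℝ i j * ((s i - s j) * (s i - s j)))
          (fun i _ => Finset.sum_nonneg fun j _ =>
            mul_nonneg (adjMatrix_nonneg G i j) (mul_self_nonneg _)) (Finset.mem_univ i)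
  rw [sum_mul_disagreement]
  linarith [sum_leaderWeight_nonneg informed s]

lemma sq_le_of_informed {i : Fin n} (hi : i ∈ informed) (s : Fin n → ℝ) :
    s i ^ 2 ≤ ∑ i, s i * disagreement G informed s 0 i := by
  have h1 : s i ^ 2 ≤ ∑ i, leaderWeight informed i * (s i * s i) :=
    calc s i ^ 2 = leaderWeight informed i * (s i * s i) := by
          rw [leaderWeight, if_pos hi]; ring
      _ ≤ _ := Finset.single_le_sum (f := fun i => leaderWeight informed i * (s i * s i))
          (fun i _ => mul_nonneg (leaderWeight_nonneg informed i) (mul_self_nonneg _))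
          (Finset.mem_univ i)
  rw [sum_mul_disagreement]
  linarith [sum_edges_nonneg G s]

/-- Induction along a walk from `i` to an informed vertex. The constant `2 C + 4` comes from `s_u² ≤
2 s_v² + 2 (s_u - s_v)²`, whose defect is the square `(s_u - 2 s_v)²`, and from the bound by twice
the form on each edge. -/
lemma exists_sq_le (hG : G.Connected) (hinf : informed.Nonempty) (i : Fin n) :
    ∃ C : ℝ, 0 ≤ C ∧ ∀ s : Fin n → ℝ, s i ^ 2 ≤ C * ∑ i, s i * disagreement G informed s 0 i := by
  obtain ⟨k, hk⟩ := hinf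
  obtain ⟨w⟩ := hG.preconnected i k
  induction w with
  | nil => exact ⟨1, zero_le_one, fun s => by rw [one_mul]; exact sq_le_of_informed hk s⟩
  | cons hadj _ ih =>
    rename_i u v w' _
    obtain ⟨C, hC, h⟩ := ih hk
    refine ⟨2 * C + 4, by positivity, fun s => ?_⟩
    have h1 := h s
    have h2 := sq_sub_le_of_adj (informed := informed) hadj s
    nlinarith [sq_nonneg (s u - 2 * s v)]

/-- Connectedness makes the disagreement form positive definite. -/
lemma exists_sum_sq_le (hG : G.Connected) (hinf : informed.Nonempty) :
    ∃ C : ℝ, 0 < C ∧ ∀ s : Fin n → ℝ,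
      ∑ i, s i ^ 2 ≤ C * ∑ i, s i * disagreement G informed s 0 i := by
  choose C hC h using exists_sq_le hG hinf (G := G)
  refine ⟨∑ i, C i + 1, add_pos_of_nonneg_of_pos (Finset.sum_nonneg fun i _ => hC i) one_pos,
    fun s => ?_⟩
  rw [add_mul, one_mul, Finset.sum_mul]
  exact (Finset.sum_le_sum fun i _ => h i s).trans
    (le_add_of_nonneg_right (sum_mul_disagreement_self_nonneg G informed s))

/-- Write `Q` for the form and `c` for the disagreement. Cauchy-Schwarz and coercivity give `Q² ≤
‖s‖² ‖c‖² ≤ C Q ‖c‖²`, and a positive `Q` cancels. This turns dissipation in `c` into decay of `Q`.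
-/
lemma form_le_sum_sq_disagreement {C : ℝ} (hC : 0 < C)
    (h : ∀ s : Fin n → ℝ, ∑ i, s i ^ 2 ≤ C * ∑ i, s i * disagreement G informed s 0 i)
    (s : Fin n → ℝ) :
    ∑ i, s i * disagreement G informed s 0 i
      ≤ C * ∑ i, disagreement G informed s 0 i ^ 2 := by
  have h1 := Finset.sum_mul_sq_le_sq_mul_sq Finset.univ s (disagreement G informed s 0)
  have h0 := sum_mul_disagreement_self_nonneg G informed s
  have hc : 0 ≤ ∑ i, disagreement G informed s 0 i ^ 2 :=
    Finset.sum_nonneg fun i _ => sq_nonneg _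
  rcases h0.eq_or_lt with h0 | h0
  · rw [← h0]; positivity
  · refine le_of_mul_le_mul_left ?_ h0
    nlinarith [mul_le_mul_of_nonneg_right (h s) hc]

/-- Robust consensus: the tracking errors of the networked first-order systems
`sᵢ' = -a cᵢ - b cᵢ / (|cᵢ| + γ exp(-lam t)) - ρ` decay exponentially. -/
lemma expDecayOn_consensus (hG : G.Connected) (hinf : informed.Nonempty) {s : Fin n → ℝ → ℝ}
    {ρ : ℝ → ℝ} {a b γ lam : ℝ} (ha : 0 < a) (hb : 0 ≤ b) (hγ : 0 < γ) (hlam : 0 < lam)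
    (hρ : ∀ t, 0 ≤ t → |ρ t| ≤ b)
    (hs : ∀ i, ∀ t ∈ Ici (0 : ℝ), HasDerivWithinAt (s i)
      (-a * disagreement G informed (fun j => s j t) 0 i
        - b / (|disagreement G informed (fun j => s j t) 0 i| + γ * Real.exp (-lam * t))
          * disagreement G informed (fun j => s j t) 0 i - ρ t) (Ici 0) t) (i : Fin n) :
    ExpDecayOn (Ici 0) (s i) := by
  obtain ⟨C, hC, hsq⟩ := exists_sum_sq_le hG hinf
  set c : Fin n → ℝ → ℝ := fun i t => disagreement G informed (fun j => s j t) 0 i with hc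
  set s' : Fin n → ℝ → ℝ := fun i t => -a * c i t
    - b / (|c i t| + γ * Real.exp (-lam * t)) * c i t - ρ t with hs'
  have hcd : ∀ i, ∀ t ∈ Ici (0 : ℝ), HasDerivWithinAt (c i)
      (disagreement G informed (fun j => s' j t) 0 i) (Ici 0) t := fun i t ht => by
    refine (HasDerivWithinAt.fun_sum fun j _ =>
      ((hs i t ht).sub (hs j t ht)).const_mul (G.adjMatrix ℝ i j)).add
      (((hs i t ht).sub_const 0).const_mul (leaderWeight informed i)) |>.congr_deriv ?_
    simp [disagreement, hs', hc]
  -- The Lyapunov function is the form itself. By symmetry its derivative is `2 ∑ s'_i c_i`, so only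
  -- the vector field paired with `c` has to be estimated.
  have hQ : ExpDecayOn (Ici 0) fun t => ∑ i, s i t * c i t := by
    refine expDecayOn_of_deriv_le isInitialInterval_Ici (κ := 2 * a / C) (C := 2 * n * b * γ)
      (lam := lam) (V' := fun t => ∑ i, 2 * (s' i t * c i t)) (by positivity) hlam
      (fun t ht => ?_) (fun t _ => sum_mul_disagreement_self_nonneg G informed _) (by positivity)
      fun t ht => ?_
    · refine (HasDerivWithinAt.fun_sum fun i _ => (hs i t ht).mul (hcd i t ht)).congr_deriv ?_
      rw [Finset.sum_add_distrib, sum_mul_disagreement_comm G informed (fun i => s i t),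
        ← Finset.sum_add_distrib]
      exact Finset.sum_congr rfl fun i _ => by simp only [hs', hc]; ring
    · have h1 : ∀ i, 2 * (s' i t * c i t) ≤ -(2 * a) * c i t ^ 2
          + 2 * b * γ * Real.exp (-lam * t) := fun i => by
        have he : 0 < γ * Real.exp (-lam * t) := by positivity
        have hpos : 0 < |c i t| + γ * Real.exp (-lam * t) := by positivity
        have hρc : -(ρ t * c i t) ≤ b * |c i t| :=
          (neg_le_abs _).trans (by
            rw [abs_mul]; exact mul_le_mul_of_nonneg_right (hρ t ht) (abs_nonneg _))
        -- With `ε = γ exp (-lam t)`, the left side equals `b ε |c| / (|c| + ε)`: smoothing the sign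
        -- function costs at most `b ε`.
        have hq : b * |c i t| - b / (|c i t| + γ * Real.exp (-lam * t)) * c i t * c i t
            ≤ b * (γ * Real.exp (-lam * t)) := by
          have : b / (|c i t| + γ * Real.exp (-lam * t)) * c i t * c i t
              = b * (|c i t| - γ * Real.exp (-lam * t))
                + b * (γ * Real.exp (-lam * t)) ^ 2
                  / (|c i t| + γ * Real.exp (-lam * t)) := by
            field_simp
            rw [← sq_abs (c i t)]; ring
          rw [this]
          have : 0 ≤ b * (γ * Real.exp (-lam * t)) ^ 2
                  / (|c i t| + γ * Real.exp (-lam * t)) := by positivity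
          linarith
        have e : s' i t * c i t = -a * c i t ^ 2
            - b / (|c i t| + γ * Real.exp (-lam * t)) * c i t * c i t - ρ t * c i t := by
          simp only [hs']; ring
        rw [e]; linarith
      have h2 := Finset.sum_le_sum fun i (_ : i ∈ Finset.univ) => h1 i
      rw [Finset.sum_add_distrib, ← Finset.mul_sum, ← Finset.mul_sum, Finset.sum_const, Finset.card_univ,
        Fintype.card_fin, nsmul_eq_mul] at h2
      have h3 := form_le_sum_sq_disagreement hC hsq (fun j => s j t)
      have h4 : 2 * a / C * ∑ i, s i t * c i t ≤ 2 * a * ∑ i, c i t ^ 2 := by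
        rw [div_mul_eq_mul_div, div_le_iff₀ hC]
        have := mul_le_mul_of_nonneg_left h3 (show 0 ≤ 2 * a by positivity)
        calc _ ≤ _ := this
          _ = _ := by ring
      simp only [← Finset.mul_sum]
      refine h2.trans ?_
      have e3 : (n : ℝ) * (2 * b * γ * Real.exp (-lam * t))
          = 2 * n * b * γ * Real.exp (-lam * t) := by ring
      rw [e3]
      linarith
  refine ExpDecayOn.of_sq_norm ((hQ.smul C).of_norm_le fun t _ => ?_)
  rw [Real.norm_of_nonneg (by positivity), Real.norm_eq_abs, sq_abs]
  refine le_trans ?_ (le_abs_self _)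
  exact (Finset.single_le_sum (f := fun i => s i t ^ 2) (fun i _ => sq_nonneg _)
    (Finset.mem_univ i)).trans (hsq fun i => s i t)

end Consensus

/-! ### Saturated double integrators via log-cosh energy and Barbalat's lemma. -/

section Saturated

lemma hasDerivAt_tanh (x : ℝ) : HasDerivAt Real.tanh (1 - Real.tanh x ^ 2) x := by
  have h := (Real.hasDerivAt_sinh x).div (Real.hasDerivAt_cosh x) (Real.cosh_pos x).ne'
  have e : Real.tanh = fun x => Real.sinh x / Real.cosh x :=
    funext Real.tanh_eq_sinh_div_cosh
  rw [e]
  refine h.congr_deriv ?_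
  have := (Real.cosh_pos x).ne'
  field_simp

lemma hasDerivAt_log_cosh (x : ℝ) :
    HasDerivAt (fun x => Real.log (Real.cosh x)) (Real.tanh x) x := by
  rw [Real.tanh_eq_sinh_div_cosh]
  exact (Real.hasDerivAt_cosh x).log (Real.cosh_pos x).ne'

lemma abs_tanh_sub_le (x y : ℝ) : |Real.tanh x - Real.tanh y| ≤ |x - y| := by
  have := Convex.norm_image_sub_le_of_norm_hasDerivWithin_le (f := Real.tanh) (C := 1)
    (fun z _ => (hasDerivAt_tanh z).hasDerivWithinAt) (fun z _ => ?_) convex_univ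
    (mem_univ y) (mem_univ x)
  · simpa using this
  · rw [Real.norm_eq_abs, abs_le]
    constructor <;> nlinarith [Real.tanh_sq_lt_one z, sq_nonneg (Real.tanh z)]

/-- `tanh` is 1-Lipschitz and has the sign of its argument. This allows the dissipation `p tanh p`
to be replaced by a function of `tanh p` alone. -/
lemma tanh_sq_le_mul_tanh (x : ℝ) : Real.tanh x ^ 2 ≤ x * Real.tanh x := by
  have h := abs_tanh_sub_le x 0
  rw [Real.tanh_zero, sub_zero, sub_zero] at h
  have hs : 0 ≤ x * Real.tanh x := by
    rw [Real.tanh_eq_sinh_div_cosh, ← mul_div_assoc]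
    refine div_nonneg ?_ (Real.cosh_pos x).le
    rcases le_total 0 x with hx | hx
    · exact mul_nonneg hx (Real.sinh_nonneg_iff.2 hx)
    · exact mul_nonneg_of_nonpos_of_nonpos hx (Real.sinh_nonpos_iff.2 hx)
  calc Real.tanh x ^ 2 = |Real.tanh x| * |Real.tanh x| := by rw [abs_mul_abs_self, pow_two]
    _ ≤ |x| * |Real.tanh x| := mul_le_mul_of_nonneg_right h (abs_nonneg _)
    _ = x * Real.tanh x := by rw [← abs_mul, abs_of_nonneg hs]

lemma tendsto_zero_of_tanh {α : Type*} {l : Filter α} {f : α → ℝ}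
    (h : Tendsto (fun t => Real.tanh (f t)) l (𝓝 0)) : Tendsto f l (𝓝 0) := by
  have hc : ContinuousAt Real.artanh 0 := by
    have e : Real.artanh = fun x => Real.log √((1 + x) / (1 - x)) := rfl
    rw [e]
    refine ContinuousAt.log (Real.continuous_sqrt.continuousAt.comp ?_) (by simp)
    exact ContinuousAt.div (by fun_prop) (by fun_prop) (by simp)
  have := hc.tendsto.comp h
  rw [Real.artanh_zero] at this
  exact this.congr fun t => Real.artanh_tanh (f t)

lemma tendsto_zero_of_sq {α : Type*} {l : Filter α} {f : α → ℝ}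
    (h : Tendsto (fun t => f t ^ 2) l (𝓝 0)) : Tendsto f l (𝓝 0) :=
  (tendsto_zero_iff_abs_tendsto_zero _).2 (by
    simpa [Real.sqrt_sq_eq_abs, Function.comp_def] using
      (Real.continuous_sqrt.tendsto 0).comp h)

/-- A Barbalat lemma: if `U ≥ 0`, `U' ≤ -W` and `W ≥ 0` is Lipschitz, then `W → 0`. -/
lemma tendsto_zero_of_deriv_le {U U' W : ℝ → ℝ} {L : ℝ} (hL : 0 < L)
    (hU : ∀ t ∈ Ici (0 : ℝ), HasDerivWithinAt U (U' t) (Ici 0) t)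
    (hU0 : ∀ t ∈ Ici (0 : ℝ), 0 ≤ U t) (hW0 : ∀ t ∈ Ici (0 : ℝ), 0 ≤ W t)
    (hle : ∀ t ∈ Ici (0 : ℝ), U' t ≤ -W t)
    (hW : ∀ s ∈ Ici (0 : ℝ), ∀ t ∈ Ici (0 : ℝ), |W t - W s| ≤ L * |t - s|) :
    Tendsto W atTop (𝓝 0) := by
  have hanti : AntitoneOn U (Ici 0) := antitoneOn_of_deriv_nonpos_right (convex_Ici 0) subset_rfl
    hU fun t ht => (hle t ht).trans (neg_nonpos.2 (hW0 t ht))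
  -- If `W t ≥ ε`, the Lipschitz bound keeps `W ≥ ε / 2` for a time `ε / (2 L)`, so `U` drops by a
  -- fixed amount. This cannot recur at late times because `U` converges.
  have hdrop : ∀ ε > 0, ∀ t ∈ Ici (0 : ℝ), ε ≤ W t →
      U (t + ε / (2 * L)) ≤ U t - ε / 2 * (ε / (2 * L)) := fun ε hε t ht hεt => by
    have ht0 : 0 ≤ t := ht
    have hd : 0 < ε / (2 * L) := by positivity
    have hsub : Icc t (t + ε / (2 * L)) ⊆ Ici 0 := fun s hs => ht0.trans hs.1
    have h := antitoneOn_of_deriv_nonpos_right (convex_Icc t (t + ε / (2 * L))) hsub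
      (U := fun s => U s + ε / 2 * s) (U' := fun s => U' s + ε / 2 * 1)
      (fun s hs => (hU s (hsub hs)).add ((hasDerivWithinAt_id s _).const_mul _))
      (fun s hs => by
        have h1 := hle s (hsub hs)
        have h2 := hW t ht s (hsub hs)
        rw [abs_of_nonneg (by linarith [hs.1] : 0 ≤ s - t)] at h2
        have h3 : L * (s - t) ≤ L * (ε / (2 * L)) :=
          mul_le_mul_of_nonneg_left (by linarith [hs.2]) hL.le
        have h4 : L * (ε / (2 * L)) = ε / 2 := by field_simp
        have h5 := (abs_le.1 (h2.trans h3)).1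
        linarith)
      (left_mem_Icc.2 (by linarith)) (right_mem_Icc.2 (by linarith)) (by linarith)
    simp only at h
    nlinarith
  have hconv : ∃ l, Tendsto U atTop (𝓝 l) := by
    -- Freezing `U` at its value at `0` for negative times gives a function antitone on the whole
    -- line.
    have hmono : Antitone fun t => U (max t 0) := fun s t hst =>
      hanti (mem_Ici.2 (le_max_right _ _)) (mem_Ici.2 (le_max_right _ _)) (max_le_max_right 0 hst)
    refine ⟨_, (tendsto_atTop_ciInf hmono ⟨0, ?_⟩).congr' ?_⟩
    · rintro _ ⟨t, rfl⟩; exact hU0 _ (mem_Ici.2 (le_max_right _ _))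
    · filter_upwards [eventually_ge_atTop 0] with t ht
      rw [max_eq_left ht]
  obtain ⟨l, hl⟩ := hconv
  have hll : ∀ t ∈ Ici (0 : ℝ), l ≤ U t := fun t ht => le_of_tendsto hl <| by
    filter_upwards [eventually_ge_atTop t] with s hs
    exact hanti ht (le_trans ht hs) hs
  rw [Metric.tendsto_nhds]
  intro ε hε
  have hev := (hl.eventually_lt_const (lt_add_of_pos_right l
    (show 0 < ε / 2 * (ε / (2 * L)) by positivity)))
  filter_upwards [hev, eventually_ge_atTop 0] with t ht ht0
  rw [Real.dist_0_eq_abs, abs_of_nonneg (hW0 t ht0)]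
  by_contra! hεt
  have h1 := hdrop ε hε t ht0 hεt
  have h2 := hll (t + ε / (2 * L)) (show (0 : ℝ) ≤ _ by positivity)
  linarith

lemma abs_sub_le_of_deriv_bound {f f' : ℝ → ℝ} {C : ℝ}
    (hf : ∀ t ∈ Ici (0 : ℝ), HasDerivWithinAt f (f' t) (Ici 0) t)
    (hC : ∀ t ∈ Ici (0 : ℝ), |f' t| ≤ C) :
    ∀ s ∈ Ici (0 : ℝ), ∀ t ∈ Ici (0 : ℝ), |f t - f s| ≤ C * |t - s| := fun _ hs _ ht =>
  Convex.norm_image_sub_le_of_norm_hasDerivWithin_le hf hC (convex_Ici 0) hs ht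

/-- Convergence of a saturated double integrator with an exponentially decaying input. -/
lemma tendsto_zero_of_saturated {p s η : ℝ → ℝ} {a b c : ℝ} (ha : 0 < a) (hb : 0 < b) (hc : 0 < c)
    (hp : ∀ t ∈ Ici (0 : ℝ), HasDerivWithinAt p
      (-a * Real.tanh (s t) - b * Real.tanh (p t)) (Ici 0) t)
    (hs : ∀ t ∈ Ici (0 : ℝ), HasDerivWithinAt s
      (-a * Real.tanh (s t) - b * Real.tanh (p t) + c * p t + η t) (Ici 0) t)
    (hη : ExpDecayOn (Ici 0) η) : Tendsto p atTop (𝓝 0) ∧ Tendsto s atTop (𝓝 0) := by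
  obtain ⟨B, μ, hμ, hB0, hB⟩ := hη.exists_common subset_rfl
  replace hB := hB μ le_rfl
  set W : ℝ → ℝ := fun t => (a * Real.tanh (s t) + b * Real.tanh (p t)) ^ 2
    + b * c * Real.tanh (p t) ^ 2 with hW
  -- The weights are chosen so that the terms `± a c p tanh s` cancel in `V'`. What remains is `-(a
  -- tanh s + b tanh p)² - b c p tanh p + a η tanh s`.
  set V : ℝ → ℝ := fun t => a * Real.log (Real.cosh (s t)) + b * Real.log (Real.cosh (p t))
    + c / 2 * p t ^ 2 with hV
  set V' : ℝ → ℝ := fun t => a * (Real.tanh (s t)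
      * (-a * Real.tanh (s t) - b * Real.tanh (p t) + c * p t + η t))
    + b * (Real.tanh (p t) * (-a * Real.tanh (s t) - b * Real.tanh (p t)))
    + c / 2 * (2 * p t * (-a * Real.tanh (s t) - b * Real.tanh (p t))) with hV'
  have hVd : ∀ t ∈ Ici (0 : ℝ), HasDerivWithinAt V (V' t) (Ici 0) t := fun t ht => by
    refine (((((hasDerivAt_log_cosh _).comp_hasDerivWithinAt t (hs t ht)).const_mul a).add
      (((hasDerivAt_log_cosh _).comp_hasDerivWithinAt t (hp t ht)).const_mul b)).add
      (((hp t ht).pow 2).const_mul (c / 2))).congr_deriv ?_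
    simp [hV']
  have hlog : ∀ x : ℝ, 0 ≤ Real.log (Real.cosh x) := fun x => Real.log_nonneg (Real.one_le_cosh x)
  have hV0 : ∀ t, c / 2 * p t ^ 2 ≤ V t := fun t => by
    have h1 := mul_nonneg ha.le (hlog (s t))
    have h2 := mul_nonneg hb.le (hlog (p t))
    simp only [hV]; linarith
  have hV'le : ∀ t ∈ Ici (0 : ℝ), V' t ≤ -W t + a * B * Real.exp (-μ * t) := fun t ht => by
    have h1 : Real.tanh (s t) * η t ≤ B * Real.exp (-μ * t) := by
      refine (le_abs_self _).trans ?_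
      rw [abs_mul]
      calc _ ≤ 1 * |η t| := by gcongr; exact (Real.abs_tanh_lt_one _).le
        _ ≤ _ := by rw [one_mul]; exact hB t ht
    have h2 := mul_le_mul_of_nonneg_left h1 ha.le
    have h3 := mul_le_mul_of_nonneg_left (tanh_sq_le_mul_tanh (p t)) (mul_pos hb hc).le
    simp only [hV', hW]
    nlinarith
  -- The added term has derivative `-a B exp (-μ t)` and absorbs the effect of `η`, so that `U' ≤
  -- -W`.
  set U : ℝ → ℝ := fun t => V t + a * B / μ * Real.exp (-μ * t) with hU
  have hUd : ∀ t ∈ Ici (0 : ℝ), HasDerivWithinAt U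
      (V' t + a * B / μ * (-μ * Real.exp (-μ * t))) (Ici 0) t := fun t ht =>
    (hVd t ht).add ((hasDerivWithinAt_exp_mul (-μ) t _).const_mul _)
  have hU'le : ∀ t ∈ Ici (0 : ℝ), V' t + a * B / μ * (-μ * Real.exp (-μ * t)) ≤ -W t :=
    fun t ht => by
      have e : a * B / μ * (-μ * Real.exp (-μ * t)) = -(a * B * Real.exp (-μ * t)) := by
        field_simp
      rw [e]; linarith [hV'le t ht]
  have hW0 : ∀ t, 0 ≤ W t := fun t => by simp only [hW]; positivity
  have hanti : AntitoneOn U (Ici 0) := antitoneOn_of_deriv_nonpos_right (convex_Ici 0) subset_rfl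
    hUd fun t ht => (hU'le t ht).trans (neg_nonpos.2 (hW0 t))
  have hVU : ∀ t, V t ≤ U t := fun t => le_add_of_nonneg_right (by positivity)
  -- Only `p` needs a bound: `s` enters the right-hand sides through `tanh`, so bounded `p` and `η`
  -- suffice for `W` to be Lipschitz.
  obtain ⟨P, hP⟩ : ∃ P, ∀ t ∈ Ici (0 : ℝ), |p t| ≤ P := by
    refine ⟨√(2 / c * U 0), fun t ht => Real.abs_le_sqrt ?_⟩
    have h1 := (hV0 t).trans ((hVU t).trans (hanti (mem_Ici.2 le_rfl) ht ht))
    rw [div_mul_eq_mul_div, le_div_iff₀ hc]; linarith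
  have htanh : ∀ x, |Real.tanh x| ≤ 1 := fun x => (Real.abs_tanh_lt_one x).le
  have hp' : ∀ t ∈ Ici (0 : ℝ), |-a * Real.tanh (s t) - b * Real.tanh (p t)| ≤ a + b :=
    fun t _ => by
      refine (abs_sub _ _).trans ?_
      rw [abs_mul, abs_mul, abs_neg, abs_of_pos ha, abs_of_pos hb]
      nlinarith [htanh (s t), htanh (p t)]
  have hs' : ∀ t ∈ Ici (0 : ℝ),
      |-a * Real.tanh (s t) - b * Real.tanh (p t) + c * p t + η t| ≤ a + b + c * P + B :=
    fun t ht => by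
      have ht0 : 0 ≤ t := ht
      refine (abs_add_le _ _).trans (add_le_add ((abs_add_le _ _).trans
        (add_le_add (hp' t ht) ?_)) ?_)
      · rw [abs_mul, abs_of_pos hc]; exact mul_le_mul_of_nonneg_left (hP t ht) hc.le
      · refine (hB t ht).trans (mul_le_of_le_one_right hB0 (Real.exp_le_one_iff.2 ?_))
        nlinarith
  have hpL := abs_sub_le_of_deriv_bound hp hp'
  have hsL := abs_sub_le_of_deriv_bound hs hs'
  set A := a + b with hA
  set N := a + b + c * P + B with hN
  have hP0 : 0 ≤ P := (abs_nonneg _).trans (hP 0 (mem_Ici.2 le_rfl))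
  have hApos : 0 < A := by positivity
  have hNpos : 0 < N := by positivity
  have hWL : ∀ t₁ ∈ Ici (0 : ℝ), ∀ t₂ ∈ Ici (0 : ℝ),
      |W t₂ - W t₁| ≤ (2 * A * (a * N + b * A) + 2 * (b * c) * A) * |t₂ - t₁| :=
    fun t₁ h₁ t₂ h₂ => by
      have hp1 := (abs_tanh_sub_le (p t₂) (p t₁)).trans (hpL t₁ h₁ t₂ h₂)
      have hs1 := (abs_tanh_sub_le (s t₂) (s t₁)).trans (hsL t₁ h₁ t₂ h₂)
      set x₁ := Real.tanh (s t₁)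
      set x₂ := Real.tanh (s t₂)
      set y₁ := Real.tanh (p t₁)
      set y₂ := Real.tanh (p t₂)
      have hx₁ : |x₁| ≤ 1 := htanh _
      have hx₂ : |x₂| ≤ 1 := htanh _
      have hy₁ : |y₁| ≤ 1 := htanh _
      have hy₂ : |y₂| ≤ 1 := htanh _
      have hcomb : ∀ x y : ℝ, |x| ≤ 1 → |y| ≤ 1 → |a * x + b * y| ≤ A := fun x y hx hy => by
        refine (abs_add_le _ _).trans ?_
        rw [abs_mul, abs_mul, abs_of_pos ha, abs_of_pos hb]
        nlinarith
      have e : W t₂ - W t₁ = ((a * x₂ + b * y₂) + (a * x₁ + b * y₁))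
          * (a * (x₂ - x₁) + b * (y₂ - y₁)) + b * c * ((y₂ + y₁) * (y₂ - y₁)) := by
        simp only [hW]; ring
      rw [e, add_mul (2 * A * _)]
      refine (abs_add_le _ _).trans (add_le_add ?_ ?_)
      · rw [abs_mul, mul_assoc]
        refine mul_le_mul ((abs_add_le _ _).trans ?_) ((abs_add_le _ _).trans ?_)
          (abs_nonneg _) (by positivity)
        · linarith [hcomb x₁ y₁ hx₁ hy₁, hcomb x₂ y₂ hx₂ hy₂]
        · rw [abs_mul, abs_mul, abs_of_pos ha, abs_of_pos hb]
          nlinarith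
      · rw [abs_mul, abs_of_pos (mul_pos hb hc), abs_mul]
        have h1 : |y₂ + y₁| ≤ 2 := (abs_add_le _ _).trans (by linarith)
        calc b * c * (|y₂ + y₁| * |y₂ - y₁|) ≤ b * c * (2 * (A * |t₂ - t₁|)) := by gcongr
          _ = _ := by ring
  have hWlim := tendsto_zero_of_deriv_le (by positivity) hUd
    (fun t _ => (by
      have h1 := hV0 t
      have h2 := hVU t
      have : 0 ≤ c / 2 * p t ^ 2 := by positivity
      linarith))
    (fun t _ => hW0 t) hU'le hWL
  have hy : Tendsto (fun t => Real.tanh (p t)) atTop (𝓝 0) := by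
    have h1 : Tendsto (fun t => Real.tanh (p t) ^ 2) atTop (𝓝 0) := by
      refine squeeze_zero (fun t => sq_nonneg _) (fun t => ?_)
        (by simpa using hWlim.div_const (b * c))
      rw [le_div_iff₀ (mul_pos hb hc)]
      simp only [hW]; nlinarith [sq_nonneg (a * Real.tanh (s t) + b * Real.tanh (p t))]
    exact tendsto_zero_of_sq h1
  have hx : Tendsto (fun t => Real.tanh (s t)) atTop (𝓝 0) := by
    have h1 : Tendsto (fun t => (a * Real.tanh (s t) + b * Real.tanh (p t)) ^ 2) atTop (𝓝 0) :=
      squeeze_zero (fun t => sq_nonneg _)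
        (fun t => le_add_of_nonneg_right (by positivity)) hWlim
    have h2 : Tendsto (fun t => a * Real.tanh (s t) + b * Real.tanh (p t)) atTop (𝓝 0) :=
      tendsto_zero_of_sq h1
    have h3 := (h2.sub (hy.const_mul b)).const_mul (1 / a)
    simp only [mul_zero, sub_zero] at h3
    refine h3.congr fun t => ?_
    field_simp
    ring
  exact ⟨tendsto_zero_of_tanh hy, tendsto_zero_of_tanh hx⟩

end Saturated

/-! ### Iterated one-sided derivatives and chains of derivatives. -/

section Jets

lemma D_zero (f : ℝ → ℝ) : D 0 f = f := by
  ext t; simp [D]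

lemma D_succ (k : ℕ) (f : ℝ → ℝ) (t : ℝ) : D (k + 1) f t = derivWithin (D k f) (Ici 0) t := by
  simp only [D, iteratedDerivWithin_succ]
  rfl

lemma D_succ_eq {k : ℕ} {f : ℝ → ℝ} {c t : ℝ} (ht : t ∈ Ici (0 : ℝ))
    (h : HasDerivWithinAt (D k f) c (Ici 0) t) : D (k + 1) f t = c := by
  rw [D_succ]
  exact h.derivWithin (uniqueDiffOn_Ici 0 t ht)

lemma TimesDiff.hasDerivWithinAt {k j : ℕ} {f : ℝ → ℝ} (hf : TimesDiff k f) (hj : j < k) {t : ℝ}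
    (ht : t ∈ Ici (0 : ℝ)) : HasDerivWithinAt (D j f) (D (j + 1) f t) (Ici 0) t := by
  rw [D_succ]
  exact (hf j hj t ht).hasDerivWithinAt

lemma TimesDiff.hasDerivWithinAt_self {k : ℕ} {f : ℝ → ℝ} (hf : TimesDiff (k + 1) f) {t : ℝ}
    (ht : t ∈ Ici (0 : ℝ)) : HasDerivWithinAt f (D 1 f t) (Ici 0) t := by
  simpa only [D_zero] using hf.hasDerivWithinAt (Nat.succ_pos k) ht

/-- Relative openness of `J` in the half line allows an identity known only on `J` to be
differentiated within `[0, ∞)`. -/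
lemma hasDerivWithinAt_congr_on {J : Set ℝ} (hJ : IsInitialInterval J) {f h : ℝ → ℝ} {c t : ℝ}
    (ht : t ∈ J) (hf : HasDerivWithinAt f c (Ici 0) t) (hfh : EqOn h f J) :
    HasDerivWithinAt h c (Ici 0) t :=
  hf.congr_of_eventuallyEq (mem_of_superset (hJ.mem_nhds t ht) hfh) (hfh ht)

/-- A chain of derivatives starting at `f` computes the derivatives of `f`. -/
lemma D_eqOn_of_chain {J : Set ℝ} (hJ : IsInitialInterval J) {m : ℕ} {F : ℕ → ℝ → ℝ} {f : ℝ → ℝ}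
    (hf : f = F 0) (hF : ∀ j < m, ∀ t ∈ J, HasDerivWithinAt (F j) (F (j + 1) t) (Ici 0) t) :
    ∀ j ≤ m, EqOn (D j f) (F j) J := by
  intro j
  induction j with
  | zero => intro _ t _; rw [D_zero, hf]
  | succ j ih =>
    intro hj t ht
    exact D_succ_eq (hJ.subset ht)
      (hasDerivWithinAt_congr_on hJ ht (hF j hj t ht) (ih (Nat.le_of_succ_le hj)))

/-- Supplies regularity not assumed of `f`: a quad-rotor's position is a priori only twice
differentiable, and its higher derivatives exist because the closed-loop formulas form a chain. -/
lemma hasDerivWithinAt_D_of_chain {J : Set ℝ} (hJ : IsInitialInterval J) {m : ℕ}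
    {F : ℕ → ℝ → ℝ} {f : ℝ → ℝ} (hf : f = F 0)
    (hF : ∀ j < m, ∀ t ∈ J, HasDerivWithinAt (F j) (F (j + 1) t) (Ici 0) t) {j : ℕ} (hj : j < m)
    {t : ℝ} (ht : t ∈ J) : HasDerivWithinAt (D j f) (D (j + 1) f t) (Ici 0) t := by
  have h := D_eqOn_of_chain hJ hf hF
  rw [h (j + 1) hj ht]
  exact hasDerivWithinAt_congr_on hJ ht (hF j hj t ht) (h j hj.le)

end Jets

/-! ### Convergence of the distributed observers. -/

section Observers

variable {n : ℕ} {G : SimpleGraph (Fin n)} [DecidableRel G.Adj] {informed : Finset (Fin n)}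

/-- The horizontal observers recover the leader's horizontal position. -/
lemma expDecayOn_horizontal (hG : G.Connected) (hinf : informed.Nonempty) {K : Gains} {g : ℝ}
    {L : Leader} (hK : K.Admissible g L) {g₅ : ℝ} {w : Fin n → ℝ → ℝ} {w₀ : ℝ → ℝ}
    (hw : IsHorizontalObserver G informed K g₅ w w₀) (hw₀ : TimesDiff 4 w₀)
    (hg₅ : ∀ t, 0 ≤ t → |D 4 w₀ t + K.g₃ * D 3 w₀ t + K.g₂ * D 2 w₀ t + K.g₁ * D 1 w₀ t| ≤ g₅)
    (i : Fin n) : ExpDecayOn (Ici 0) (fun t => w i t - w₀ t) := by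
  set e : Fin n → ℕ → ℝ → ℝ := fun i k t => D k (w i) t - D k w₀ t with he
  have hed : ∀ i, ∀ k < 4, ∀ t ∈ Ici (0 : ℝ),
      HasDerivWithinAt (e i k) (e i (k + 1) t) (Ici 0) t := fun i k hk t ht =>
    ((hw i).1.hasDerivWithinAt hk ht).sub (hw₀.hasDerivWithinAt hk ht)
  -- `s` is `e` under the Hurwitz operator `X³ + g₃ X² + g₂ X + g₁`. By linearity `cTerm` is the
  -- disagreement of `s`, and the observer equation becomes the consensus system with `ρ` the same
  -- operator applied to the leader's velocity.
  set s : Fin n → ℝ → ℝ := fun i t => e i 3 t + K.g₃ * e i 2 t + K.g₂ * e i 1 t + K.g₁ * e i 0 t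
    with hs
  have hc : ∀ i t, cTerm G informed K w w₀ i t = disagreement G informed (fun j => s j t) 0 i :=
    fun i t => by
      simp only [cTerm, disagreement, hs, he, D_zero]
      have e1 : ∀ (u : Fin n → ℝ), ∑ j, G.adjMatrix ℝ i j * (u i - u j)
          = (∑ j, G.adjMatrix ℝ i j) * u i - ∑ j, G.adjMatrix ℝ i j * u j := fun u => by
        rw [Finset.sum_mul, ← Finset.sum_sub_distrib]
        exact Finset.sum_congr rfl fun j _ => by ring
      have e2 : ∀ c₀ : ℝ, ∑ j, G.adjMatrix ℝ i j * c₀ = (∑ j, G.adjMatrix ℝ i j) * c₀ :=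
        fun c₀ => (Finset.sum_mul _ _ _).symm
      have e3 : ∀ (c : ℝ) (u : Fin n → ℝ), ∑ j, G.adjMatrix ℝ i j * (c * u j)
          = c * ∑ j, G.adjMatrix ℝ i j * u j := fun c u => by
        rw [Finset.mul_sum]
        exact Finset.sum_congr rfl fun j _ => by ring
      rw [e1 fun j => D 3 (w j) t, e1 fun j => D 2 (w j) t, e1 fun j => D 1 (w j) t,
        e1 fun j => w j t, e1 fun j => D 3 (w j) t - D 3 w₀ t + K.g₃ * (D 2 (w j) t - D 2 w₀ t)
        + K.g₂ * (D 1 (w j) t - D 1 w₀ t) + K.g₁ * (w j t - w₀ t)]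
      simp only [mul_add, mul_sub, Finset.sum_add_distrib, Finset.sum_sub_distrib, e3, e2]
      ring
  have hsd : ∀ i, ExpDecayOn (Ici 0) (s i) := fun i => by
    refine expDecayOn_consensus hG hinf hK.g₄_pos
      ((abs_nonneg _).trans (hg₅ 0 le_rfl)) hK.γ_pos hK.lam_pos hg₅ (fun i t ht => ?_) i
    refine ((((hed i 3 (by norm_num) t ht).add
      ((hed i 2 (by norm_num) t ht).const_mul K.g₃)).add
      ((hed i 1 (by norm_num) t ht).const_mul K.g₂)).add
      ((hed i 0 (by norm_num) t ht).const_mul K.g₁)).congr_deriv ?_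
    have h4 := (hw i).2 t ht
    rw [hc] at h4
    simp only [he, zero_add, Nat.reduceAdd, h4]
    ring
  have key := expDecayOn_of_stable isInitialInterval_Ici 3
    (fun | 0 => K.g₁ | 1 => K.g₂ | _ => K.g₃) (y := e i) (fun z hz => ?_)
    (fun j hj => hed i j (by omega)) ((hsd i).congr fun t _ => ?_) 0 (by norm_num)
  · simpa only [he, D_zero] using key
  · refine re_neg_of_cubic hK.g₃_pos hK.g₂_pos hK.g₁_pos hK.g₁_lt (s := z) ?_
    rw [← hz]
    simp [Finset.sum_range_succ]
    ring
  · simp [Finset.sum_range_succ, hs]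
    ring

/-- The altitude observers recover the leader's altitude. -/
lemma tendsto_altitude_observer (hG : G.Connected) (hinf : informed.Nonempty) {K : Gains} {g : ℝ}
    {L : Leader} (hK : K.Admissible g L) {o : Fin n → Obs} (ho : IsObserver G informed K L o)
    (i : Fin n) : Tendsto (fun t => (o i).z t - L.z) atTop (𝓝 0) := by
  have hzb : ExpDecayOn (Ici 0) (fun t => (o i).zb t - L.z) := by
    -- With `b = 0` the robust term disappears, and the values `1` for `γ` and `lam` play no role.
    refine expDecayOn_consensus hG hinf (s := fun i t => (o i).zb t - L.z) (ρ := 0) hK.h₆_pos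
      le_rfl one_pos one_pos (fun _ _ => by simp) (fun i t ht => ?_) i
    refine (((ho.diff_zb i).hasDerivWithinAt_self ht).sub_const L.z).congr_deriv ?_
    rw [ho.eq_zb i t ht, disagreement_eq_sub]
    simp
  set y : ℕ → ℝ → ℝ := fun k t => D k (o i).za t - if k = 0 then L.z else 0 with hy
  have hyd : ∀ j < 2, ∀ t ∈ Ici (0 : ℝ), HasDerivWithinAt (y j) (y (j + 1) t) (Ici 0) t :=
    fun j hj t ht => (((ho.diff_za i).hasDerivWithinAt hj ht).sub_const _).congr_deriv (by simp [hy])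
  have hza := expDecayOn_of_stable isInitialInterval_Ici 2
    (fun | 0 => K.h₄ | _ => K.h₅) (fun z hz => ?_) hyd
    ((hzb.smul K.h₄).congr fun t ht => ?_)
  · have h0 : ExpDecayOn (Ici 0) fun t => (o i).za t - L.z := by
      simpa [hy, D_zero] using hza 0 (by norm_num)
    have h1 : ExpDecayOn (Ici 0) (D 1 (o i).za) := by
      simpa [hy] using hza 1 (by norm_num)
    obtain ⟨hp, hs⟩ := tendsto_zero_of_saturated (p := D 1 (o i).z)
      (s := fun t => D 1 (o i).z t + K.h₂ * ((o i).z t - (o i).za t))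
      (η := fun t => (-K.h₂) • D 1 (o i).za t) hK.h₁_pos hK.h₃_pos hK.h₂_pos
      (fun t ht => ((ho.diff_z i).hasDerivWithinAt (j := 1) (by norm_num) ht).congr_deriv
        (ho.eq_z i t ht))
      (fun t ht => by
        refine (((ho.diff_z i).hasDerivWithinAt (j := 1) (by norm_num) ht).add
          ((((ho.diff_z i).hasDerivWithinAt_self ht).sub
            ((ho.diff_za i).hasDerivWithinAt_self ht)).const_mul K.h₂)).congr_deriv ?_
        rw [ho.eq_z i t ht, smul_eq_mul]
        ring)
      (h1.smul _)
    have h2 := ((hs.sub hp).div_const K.h₂).add h0.tendsto_zero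
    rw [sub_zero, zero_div, add_zero] at h2
    refine h2.congr fun t => ?_
    have := hK.h₂_pos.ne'
    field_simp
    ring
  · refine re_neg_of_quadratic hK.h₅_pos hK.h₄_pos (s := z) ?_
    rw [← hz]
    simp [Finset.sum_range_succ]
    ring
  · have := ho.eq_za i t ht
    simp [hy, Finset.sum_range_succ, this, D_zero]
    ring

end Observers

/-! ### Thrust and altitude error of one follower. -/

section Altitude

variable {g : ℝ} {K : Gains} {q : Quad} {o : Obs} {d : Fin 3 → ℝ}

lemma hasDerivWithinAt_ez (hqz : TimesDiff 2 q.z) (hoz : TimesDiff 2 o.z) {j : ℕ} (hj : j < 2)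
    {t : ℝ} (ht : t ∈ Ici (0 : ℝ)) :
    HasDerivWithinAt (D j (ez q o d)) (D (j + 1) (ez q o d) t) (Ici 0) t :=
  hasDerivWithinAt_D_of_chain isInitialInterval_Ici
    (F := fun j t => D j q.z t - D j o.z t - if j = 0 then d 2 else 0)
    (by ext t; simp [ez, D_zero])
    (fun j hj t ht => (((hqz.hasDerivWithinAt hj ht).sub
      (hoz.hasDerivWithinAt hj ht)).sub_const _).congr_deriv (by simp)) hj ht

lemma D_two_ez (hqz : TimesDiff 2 q.z) (hoz : TimesDiff 2 o.z) {t : ℝ} (ht : t ∈ Ici (0 : ℝ)) :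
    D 2 (ez q o d) t = D 2 q.z t - D 2 o.z t := by
  have := D_eqOn_of_chain isInitialInterval_Ici (f := ez q o d)
    (F := fun j t => D j q.z t - D j o.z t - if j = 0 then d 2 else 0)
    (by ext t; simp [ez, D_zero])
    (fun j hj t ht => (((hqz.hasDerivWithinAt hj ht).sub
      (hoz.hasDerivWithinAt hj ht)).sub_const _).congr_deriv (by simp)) 2 le_rfl ht
  simpa using this

lemma HasDerivWithinAt.tanh {f : ℝ → ℝ} {f' t : ℝ} {s : Set ℝ} (hf : HasDerivWithinAt f f' s t) :
    HasDerivWithinAt (fun t => Real.tanh (f t)) ((1 - Real.tanh (f t) ^ 2) * f') s t :=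
  (hasDerivAt_tanh (f t)).comp_hasDerivWithinAt t hf

/-- The saturation `|tanh| < 1` limits the feedback to `kz₁ + kz₃`. No condition on the attitude
enters, so positivity is available before the singularity is excluded. -/
lemma ubar_pos (hkz₁ : 0 < K.kz₁) (hkz₃ : 0 < K.kz₃) {t : ℝ}
    (hkz : K.kz₁ + K.kz₃ < g - |D 2 o.z t|) : 0 < ubar g K q o d t := by
  have h1 := (abs_le.1 (Real.abs_tanh_lt_one (D 1 (ez q o d) t + K.kz₂ * ez q o d t)).le).2
  have h2 := (abs_le.1 (Real.abs_tanh_lt_one (D 1 (ez q o d) t)).le).2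
  have h3 := neg_abs_le (D 2 o.z t)
  unfold ubar
  nlinarith

/-- The closed-loop altitude error dynamics away from the attitude singularity. -/
lemma D_two_ez_eq (hq : IsControlled g K q o d) (hoz : TimesDiff 2 o.z) {t : ℝ}
    (ht : t ∈ Ici (0 : ℝ)) (hθ : Real.cos (q.θ t) ≠ 0) (hφ : Real.cos (q.φ t) ≠ 0) :
    D 2 (ez q o d) t = - K.kz₁ * Real.tanh (D 1 (ez q o d) t + K.kz₂ * ez q o d t)
      - K.kz₃ * Real.tanh (D 1 (ez q o d) t) := by
  rw [D_two_ez hq.diff_z hoz ht, hq.eq_z t ht, u₁]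
  have : 1 / (Real.cos (q.θ t) * Real.cos (q.φ t)) * ubar g K q o d t * Real.cos (q.θ t)
      * Real.cos (q.φ t) = ubar g K q o d t := by field_simp
  rw [this, ubar]; ring

variable {J : Set ℝ}

/-- The altitude is assumed only twice differentiable. The third derivative exists because the
closed-loop equation writes the second one through `ez` and its first derivative. -/
lemma hasDerivWithinAt_D_two_ez (hJ : IsInitialInterval J) (hq : IsControlled g K q o d)
    (hoz : TimesDiff 2 o.z)
    (hcos : ∀ t ∈ J, Real.cos (q.θ t) ≠ 0 ∧ Real.cos (q.φ t) ≠ 0) {t : ℝ} (ht : t ∈ J) :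
    HasDerivWithinAt (D 2 (ez q o d)) (ez3 K q o d t) (Ici 0) t := by
  have h0 := hasDerivWithinAt_ez (d := d) hq.diff_z hoz (j := 0) (by norm_num) (hJ.subset ht)
  rw [D_zero] at h0
  have h1 := hasDerivWithinAt_ez (d := d) hq.diff_z hoz (j := 1) (by norm_num) (hJ.subset ht)
  refine hasDerivWithinAt_congr_on hJ ht ?_ fun s hs =>
    D_two_ez_eq hq hoz (hJ.subset hs) (hcos s hs).1 (hcos s hs).2
  refine (((HasDerivWithinAt.tanh (h1.add (h0.const_mul K.kz₂))).const_mul (-K.kz₁)).sub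
    ((HasDerivWithinAt.tanh h1).const_mul K.kz₃)).congr_deriv ?_
  simp only [ez3, sech2a, sech2b, Pi.add_apply, zero_add, Nat.reduceAdd]
  ring

/-- `ū₁` contains the altitude error only up to first order, so no attitude condition is needed.
This gives continuity of `ū₁` up to and including a possible singular time. -/
lemma hasDerivWithinAt_ubar (hqz : TimesDiff 2 q.z) (hoz : TimesDiff 4 o.z) {t : ℝ}
    (ht : t ∈ Ici (0 : ℝ)) : HasDerivWithinAt (ubar g K q o d) (ubar' K q o d t) (Ici 0) t := by
  have hoz2 : TimesDiff 2 o.z := fun j hj => hoz j (by omega)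
  have h0 := hasDerivWithinAt_ez (d := d) hqz hoz2 (j := 0) (by norm_num) ht
  rw [D_zero] at h0
  have h1 := hasDerivWithinAt_ez (d := d) hqz hoz2 (j := 1) (by norm_num) ht
  refine ((((hoz.hasDerivWithinAt (j := 2) (by norm_num) ht).const_add g).sub
    ((HasDerivWithinAt.tanh (h1.add (h0.const_mul K.kz₂))).const_mul K.kz₁)).sub
    ((HasDerivWithinAt.tanh h1).const_mul K.kz₃)).congr_deriv ?_
  simp only [ubar', sech2a, sech2b, Pi.add_apply, zero_add, Nat.reduceAdd]
  ring

lemma hasDerivWithinAt_ubar' (hJ : IsInitialInterval J) (hq : IsControlled g K q o d)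
    (hoz : TimesDiff 4 o.z)
    (hcos : ∀ t ∈ J, Real.cos (q.θ t) ≠ 0 ∧ Real.cos (q.φ t) ≠ 0) {t : ℝ} (ht : t ∈ J) :
    HasDerivWithinAt (ubar' K q o d) (ubar'' K q o d t) (Ici 0) t := by
  have hoz2 : TimesDiff 2 o.z := fun j hj => hoz j (by omega)
  have h0 := hasDerivWithinAt_ez (d := d) hq.diff_z hoz2 (j := 0) (by norm_num) (hJ.subset ht)
  rw [D_zero] at h0
  have h1 := hasDerivWithinAt_ez (d := d) hq.diff_z hoz2 (j := 1) (by norm_num) (hJ.subset ht)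
  have h2 := hasDerivWithinAt_D_two_ez hJ hq hoz2 hcos ht
  have ha := ((HasDerivWithinAt.tanh (h1.add (h0.const_mul K.kz₂))).pow 2).const_sub 1
  have hb := ((HasDerivWithinAt.tanh h1).pow 2).const_sub 1
  refine (((hoz.hasDerivWithinAt (j := 3) (by norm_num) (hJ.subset ht)).sub
    ((hb.const_mul K.kz₃).mul h2)).sub
    ((ha.const_mul K.kz₁).mul (h2.add (h1.const_mul K.kz₂)))).congr_deriv ?_
  simp only [ubar'', sech2a, sech2b, Pi.add_apply, Pi.pow_apply, zero_add, Nat.reduceAdd]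
  push_cast
  ring

end Altitude

/-! ### Exact linearization of the horizontal dynamics. -/

section FeedbackLinearization

/-- The derivatives of `a (c A + s B)` for a rotating frame `(c, s)` of angular velocity `p`. -/
lemma hasDerivWithinAt_rotating {a c s A B : ℝ → ℝ} {a' p m₁ m₂ t : ℝ} {I : Set ℝ}
    (ha : HasDerivWithinAt a a' I t) (hc : HasDerivWithinAt c (-s t * p) I t)
    (hs : HasDerivWithinAt s (c t * p) I t) (hA : HasDerivWithinAt A m₁ I t)
    (hB : HasDerivWithinAt B m₂ I t) :
    HasDerivWithinAt (fun t => a t * (c t * A t + s t * B t))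
      (a' * (c t * A t + s t * B t)
        + a t * (p * (-s t * A t + c t * B t) + (c t * m₁ + s t * m₂))) I t :=
  (ha.mul ((hc.mul hA).add (hs.mul hB))).congr_deriv (by simp only [Pi.add_apply, Pi.mul_apply]; ring)

/-- Differentiates the formula of `hasDerivWithinAt_rotating` once more. Here `m₁, m₂` are the first
and `n₁, n₂` the second derivatives of `A, B`; the `-p²` term is the second derivative of the frame.
-/
lemma hasDerivWithinAt_rotating₂ {a a' c s A B p m₁ m₂ : ℝ → ℝ} {a'' p' n₁ n₂ t : ℝ} {I : Set ℝ}
    (ha : HasDerivWithinAt a (a' t) I t) (ha' : HasDerivWithinAt a' a'' I t)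
    (hc : HasDerivWithinAt c (-s t * p t) I t) (hs : HasDerivWithinAt s (c t * p t) I t)
    (hp : HasDerivWithinAt p p' I t)
    (hA : HasDerivWithinAt A (m₁ t) I t) (hB : HasDerivWithinAt B (m₂ t) I t)
    (hm₁ : HasDerivWithinAt m₁ n₁ I t) (hm₂ : HasDerivWithinAt m₂ n₂ I t) :
    HasDerivWithinAt (fun t => a' t * (c t * A t + s t * B t)
        + a t * (p t * (-s t * A t + c t * B t) + (c t * m₁ t + s t * m₂ t)))
      (a'' * (c t * A t + s t * B t)
        + 2 * a' t * (p t * (-s t * A t + c t * B t) + (c t * m₁ t + s t * m₂ t))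
        + a t * (p' * (-s t * A t + c t * B t) - p t ^ 2 * (c t * A t + s t * B t)
          + 2 * p t * (-s t * m₁ t + c t * m₂ t) + (c t * n₁ + s t * n₂))) I t :=
  ((ha'.mul ((hc.mul hA).add (hs.mul hB))).add
    (ha.mul ((hp.mul ((hs.neg.mul hA).add (hc.mul hB))).add
      ((hc.mul hm₁).add (hs.mul hm₂))))).congr_deriv
    (by simp only [Pi.add_apply, Pi.mul_apply, Pi.neg_apply]; ring)

lemma hasDerivAt_sec {x : ℝ} (hx : Real.cos x ≠ 0) :
    HasDerivAt sec (sec x * Real.tan x) x := by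
  have h := (Real.hasDerivAt_cos x).inv hx
  have e : sec = Real.cos⁻¹ := by ext y; simp [sec]
  rw [e]
  refine h.congr_deriv ?_
  rw [Real.tan_eq_sin_div_cos]
  simp only [Pi.inv_apply]
  field_simp

lemma hasDerivAt_tan_sec {x : ℝ} (hx : Real.cos x ≠ 0) :
    HasDerivAt Real.tan (sec x ^ 2) x :=
  (Real.hasDerivAt_tan hx).congr_deriv (by simp [sec])

/-- The chain of derivatives of a horizontal coordinate: position, velocity, and the three
derivatives of the acceleration `a (c A + s B)`. -/
noncomputable def accelerationChain (x a a' c s p A B m₁ m₂ a'' p' n₁ n₂ : ℝ → ℝ) : ℕ → ℝ → ℝ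
  | 0 => x
  | 1 => D 1 x
  | 2 => fun t => a t * (c t * A t + s t * B t)
  | 3 => fun t => a' t * (c t * A t + s t * B t)
        + a t * (p t * (-s t * A t + c t * B t) + (c t * m₁ t + s t * m₂ t))
  | _ => fun t => a'' t * (c t * A t + s t * B t)
        + 2 * a' t * (p t * (-s t * A t + c t * B t) + (c t * m₁ t + s t * m₂ t))
        + a t * (p' t * (-s t * A t + c t * B t) - p t ^ 2 * (c t * A t + s t * B t)
          + 2 * p t * (-s t * m₁ t + c t * m₂ t) + (c t * n₁ t + s t * n₂ t))

variable {g : ℝ} {K : Gains} {q : Quad} {o : Obs} {d : Fin 3 → ℝ}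

lemma mulVec_apply_two (A : Matrix (Fin 2) (Fin 2) ℝ) (v : Fin 2 → ℝ) (i : Fin 2) :
    (A *ᵥ v) i = A i 0 * v 0 + A i 1 * v 1 := by
  rw [Matrix.mulVec, dotProduct, Fin.sum_univ_two]

lemma mul_apply_two (A B : Matrix (Fin 2) (Fin 2) ℝ) (i j : Fin 2) :
    (A * B) i j = A i 0 * B 0 j + A i 1 * B 1 j := by
  rw [Matrix.mul_apply, Fin.sum_univ_two]

lemma isUnit_det_M {t : ℝ} (hθ : Real.cos (q.θ t) ≠ 0) (hφ : Real.cos (q.φ t) ≠ 0) :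
    IsUnit (M q t).det := by
  rw [isUnit_iff_ne_zero, M, Matrix.det_fin_two_of]
  have h1 : sec (q.θ t) ≠ 0 := one_div_ne_zero hθ
  have h2 : sec (q.φ t) ≠ 0 := one_div_ne_zero hφ
  simp [h1, h2]

lemma isUnit_det_S : IsUnit S.det := by
  simp [S, Matrix.det_fin_two_of]

lemma isUnit_det_R₂ (α : ℝ) : IsUnit (R₂ α).det := by
  rw [R₂, Matrix.det_fin_two_of]
  have : Real.cos α * Real.cos α - -Real.sin α * Real.sin α = 1 := by
    nlinarith [Real.sin_sq_add_cos_sq α]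
  rw [this]; exact isUnit_one

/-- The law for `(u₂, u₃)` inverts the decoupling matrix. -/
lemma decoupling_mulVec_u₂₃ {t : ℝ} (hθ : Real.cos (q.θ t) ≠ 0) (hφ : Real.cos (q.φ t) ≠ 0)
    (hu : ubar g K q o d t ≠ 0) :
    (ubar g K q o d t • (R₂ (q.ψ t) * S * M q t)) *ᵥ u₂₃ g K q o d t =
      ![D 4 o.x t, D 4 o.y t] - Ξ₂ g K q o d t + ![ux K q o d t, uy K q o d t] := by
  have e : (R₂ (q.ψ t) * S * M q t) * ((M q t)⁻¹ * S⁻¹ * (R₂ (q.ψ t))⁻¹) = 1 := by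
    have h1 := Matrix.mul_nonsing_inv _ (isUnit_det_M hθ hφ)
    have h2 := Matrix.mul_nonsing_inv _ isUnit_det_S
    have h3 := Matrix.mul_nonsing_inv _ (isUnit_det_R₂ (q.ψ t))
    calc _ = R₂ (q.ψ t) * (S * (M q t * (M q t)⁻¹) * S⁻¹) * (R₂ (q.ψ t))⁻¹ := by
          simp only [Matrix.mul_assoc]
      _ = 1 := by rw [h1, Matrix.mul_one, h2, Matrix.mul_one, h3]
  rw [u₂₃, Matrix.smul_mulVec, Matrix.mulVec_smul, Matrix.mulVec_mulVec, e, Matrix.one_mulVec,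
    smul_smul, mul_one_div_cancel hu, one_smul]

variable {J : Set ℝ}

/-- Away from the attitude singularity the closed-loop horizontal errors satisfy the linear
fourth-order equations. -/
lemma horizontal_error_dynamics (hJ : IsInitialInterval J) (hq : IsControlled g K q o d)
    (hox : TimesDiff 4 o.x) (hoy : TimesDiff 4 o.y) (hoz : TimesDiff 4 o.z)
    (hcos : ∀ t ∈ J, Real.cos (q.θ t) ≠ 0 ∧ Real.cos (q.φ t) ≠ 0)
    (hu : ∀ t ∈ J, ubar g K q o d t ≠ 0) :
    (∀ t ∈ J, (∀ j < 4, HasDerivWithinAt (D j (ex q o d)) (D (j + 1) (ex q o d) t) (Ici 0) t)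
      ∧ D 4 (ex q o d) t = ux K q o d t
      ∧ D 2 (ex q o d) t + D 2 o.x t = ubar g K q o d t * (Real.cos (q.ψ t) * tanVec q t 0
        + Real.sin (q.ψ t) * tanVec q t 1)) ∧
    (∀ t ∈ J, (∀ j < 4, HasDerivWithinAt (D j (ey q o d)) (D (j + 1) (ey q o d) t) (Ici 0) t)
      ∧ D 4 (ey q o d) t = uy K q o d t
      ∧ D 2 (ey q o d) t + D 2 o.y t = ubar g K q o d t * (Real.sin (q.ψ t) * tanVec q t 0
        + -Real.cos (q.ψ t) * tanVec q t 1)) := by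
  have hψ0 : ∀ t ∈ J, HasDerivWithinAt q.ψ (D 1 q.ψ t) (Ici 0) t := fun t ht =>
    hq.diff_ψ.hasDerivWithinAt_self (hJ.subset ht)
  have hφ0 : ∀ t ∈ J, HasDerivWithinAt q.φ (D 1 q.φ t) (Ici 0) t := fun t ht =>
    hq.diff_φ.hasDerivWithinAt_self (hJ.subset ht)
  have hθ0 : ∀ t ∈ J, HasDerivWithinAt q.θ (D 1 q.θ t) (Ici 0) t := fun t ht =>
    hq.diff_θ.hasDerivWithinAt_self (hJ.subset ht)
  have hψ1 : ∀ t ∈ J, HasDerivWithinAt (D 1 q.ψ) (D 2 q.ψ t) (Ici 0) t := fun t ht =>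
    hq.diff_ψ.hasDerivWithinAt (by norm_num) (hJ.subset ht)
  have hφ1 : ∀ t ∈ J, HasDerivWithinAt (D 1 q.φ) (D 2 q.φ t) (Ici 0) t := fun t ht =>
    hq.diff_φ.hasDerivWithinAt (by norm_num) (hJ.subset ht)
  have hθ1 : ∀ t ∈ J, HasDerivWithinAt (D 1 q.θ) (D 2 q.θ t) (Ici 0) t := fun t ht =>
    hq.diff_θ.hasDerivWithinAt (by norm_num) (hJ.subset ht)
  -- `μ` and `ν` are the first and second time derivatives of `tanVec`; only `ν` contains the
  -- angular accelerations, hence the inputs.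
  set μ : ℝ → Fin 2 → ℝ := fun t => M q t *ᵥ rates q t with hμ
  set ν : ℝ → Fin 2 → ℝ := fun t => M' q t *ᵥ rates q t + M q t *ᵥ ![D 2 q.φ t, D 2 q.θ t]
    with hν
  have htθ : ∀ t ∈ J, HasDerivWithinAt (fun t => Real.tan (q.θ t))
      (sec (q.θ t) ^ 2 * D 1 q.θ t) (Ici 0) t := fun t ht =>
    (hasDerivAt_tan_sec (hcos t ht).1).comp_hasDerivWithinAt t (hθ0 t ht)
  have htφ : ∀ t ∈ J, HasDerivWithinAt (fun t => Real.tan (q.φ t))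
      (sec (q.φ t) ^ 2 * D 1 q.φ t) (Ici 0) t := fun t ht =>
    (hasDerivAt_tan_sec (hcos t ht).2).comp_hasDerivWithinAt t (hφ0 t ht)
  have hsθ : ∀ t ∈ J, HasDerivWithinAt (fun t => sec (q.θ t))
      (sec (q.θ t) * Real.tan (q.θ t) * D 1 q.θ t) (Ici 0) t := fun t ht =>
    (hasDerivAt_sec (hcos t ht).1).comp_hasDerivWithinAt t (hθ0 t ht)
  have hsφ : ∀ t ∈ J, HasDerivWithinAt (fun t => sec (q.φ t))
      (sec (q.φ t) * Real.tan (q.φ t) * D 1 q.φ t) (Ici 0) t := fun t ht =>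
    (hasDerivAt_sec (hcos t ht).2).comp_hasDerivWithinAt t (hφ0 t ht)
  have hA : ∀ t ∈ J, HasDerivWithinAt (fun t => tanVec q t 0) (μ t 0) (Ici 0) t :=
    fun t ht => (htθ t ht).congr_deriv (by simp [hμ, M, rates, mul_comm])
  have hB : ∀ t ∈ J, HasDerivWithinAt (fun t => tanVec q t 1) (μ t 1) (Ici 0) t := fun t ht => by
    have e : (fun t => tanVec q t 1) = fun t => Real.tan (q.φ t) * sec (q.θ t) := by
      ext t; simp [tanVec, sec, div_eq_mul_inv]
    rw [e]
    refine ((htφ t ht).mul (hsθ t ht)).congr_deriv ?_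
    simp [hμ, M, rates]
    ring
  have hμ0 : ∀ t ∈ J, HasDerivWithinAt (fun t => μ t 0) (ν t 0) (Ici 0) t := fun t ht => by
    have e : (fun t => μ t 0) = fun t => sec (q.θ t) ^ 2 * D 1 q.θ t := by
      ext t; simp [hμ, M, rates]; ring
    rw [e]
    refine (((hsθ t ht).pow 2).mul (hθ1 t ht)).congr_deriv ?_
    simp [hν, M, M', rates]
    ring
  have hμ1 : ∀ t ∈ J, HasDerivWithinAt (fun t => μ t 1) (ν t 1) (Ici 0) t := fun t ht => by
    have e : (fun t => μ t 1) = fun t => sec (q.φ t) ^ 2 * sec (q.θ t) * D 1 q.φ t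
        + Real.tan (q.φ t) * Real.tan (q.θ t) * sec (q.θ t) * D 1 q.θ t := by
      ext t; simp [hμ, M, rates]; ring
    rw [e]
    refine (((((hsφ t ht).pow 2).mul (hsθ t ht)).mul (hφ1 t ht)).add
      ((((htφ t ht).mul (htθ t ht)).mul (hsθ t ht)).mul (hθ1 t ht))).congr_deriv ?_
    simp [hν, M, M', rates]
    ring
  have hu0 : ∀ t ∈ J, HasDerivWithinAt (ubar g K q o d) (ubar' K q o d t) (Ici 0) t := fun t ht =>
    hasDerivWithinAt_ubar hq.diff_z hoz (hJ.subset ht)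
  have hu1 : ∀ t ∈ J, HasDerivWithinAt (ubar' K q o d) (ubar'' K q o d t) (Ici 0) t :=
    fun t ht => hasDerivWithinAt_ubar' hJ hq hoz hcos ht
  have hc : ∀ t ∈ J, HasDerivWithinAt (fun t => Real.cos (q.ψ t))
      (-Real.sin (q.ψ t) * D 1 q.ψ t) (Ici 0) t := fun t ht => (hψ0 t ht).cos
  have hs : ∀ t ∈ J, HasDerivWithinAt (fun t => Real.sin (q.ψ t))
      (Real.cos (q.ψ t) * D 1 q.ψ t) (Ici 0) t := fun t ht => (hψ0 t ht).sin
  -- The `y` channel is the `x` channel with the frame `(sin ψ, -cos ψ)`, which satisfies the same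
  -- rotation equations `c' = -s ψ'`, `s' = c ψ'`.
  have hc' : ∀ t ∈ J, HasDerivWithinAt (fun t => -Real.cos (q.ψ t))
      (Real.sin (q.ψ t) * D 1 q.ψ t) (Ici 0) t := fun t ht =>
    (hc t ht).neg.congr_deriv (by ring)
  have hs' : ∀ t ∈ J, HasDerivWithinAt (fun t => Real.sin (q.ψ t))
      (-(-Real.cos (q.ψ t)) * D 1 q.ψ t) (Ici 0) t := fun t ht =>
    (hs t ht).congr_deriv (by ring)
  set FX := accelerationChain q.x (ubar g K q o d) (ubar' K q o d) (fun t => Real.cos (q.ψ t))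
    (fun t => Real.sin (q.ψ t)) (D 1 q.ψ) (fun t => tanVec q t 0) (fun t => tanVec q t 1)
    (fun t => μ t 0) (fun t => μ t 1) (ubar'' K q o d) (D 2 q.ψ) (fun t => ν t 0)
    (fun t => ν t 1) with hFX
  set FY := accelerationChain q.y (ubar g K q o d) (ubar' K q o d) (fun t => Real.sin (q.ψ t))
    (fun t => -Real.cos (q.ψ t)) (D 1 q.ψ) (fun t => tanVec q t 0) (fun t => tanVec q t 1)
    (fun t => μ t 0) (fun t => μ t 1) (ubar'' K q o d) (D 2 q.ψ) (fun t => ν t 0)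
    (fun t => ν t 1) with hFY
  have hx : ∀ j < 4, ∀ t ∈ J, HasDerivWithinAt (FX j) (FX (j + 1) t) (Ici 0) t := by
    intro j hj t ht
    obtain ⟨h1, h2⟩ := hcos t ht
    interval_cases j
    · exact hq.diff_x.hasDerivWithinAt_self (hJ.subset ht)
    · refine (hq.diff_x.hasDerivWithinAt (j := 1) (by norm_num) (hJ.subset ht)).congr_deriv ?_
      rw [hq.eq_x t (hJ.subset ht)]
      simp only [hFX, accelerationChain, u₁, tanVec, Real.tan_eq_sin_div_cos, Matrix.cons_val_zero,
        Matrix.cons_val_one]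
      field_simp
    · exact hasDerivWithinAt_rotating (hu0 t ht) (hc t ht) (hs t ht) (hA t ht) (hB t ht)
    · exact hasDerivWithinAt_rotating₂ (hu0 t ht) (hu1 t ht) (hc t ht) (hs t ht) (hψ1 t ht)
        (hA t ht) (hB t ht) (hμ0 t ht) (hμ1 t ht)
  have hy : ∀ j < 4, ∀ t ∈ J, HasDerivWithinAt (FY j) (FY (j + 1) t) (Ici 0) t := by
    intro j hj t ht
    obtain ⟨h1, h2⟩ := hcos t ht
    interval_cases j
    · exact hq.diff_y.hasDerivWithinAt_self (hJ.subset ht)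
    · refine (hq.diff_y.hasDerivWithinAt (j := 1) (by norm_num) (hJ.subset ht)).congr_deriv ?_
      rw [hq.eq_y t (hJ.subset ht)]
      simp only [hFY, accelerationChain, u₁, tanVec, Real.tan_eq_sin_div_cos, Matrix.cons_val_zero,
        Matrix.cons_val_one]
      field_simp
      ring
    · exact hasDerivWithinAt_rotating (hu0 t ht) (hs' t ht) (hc' t ht) (hA t ht) (hB t ht)
    · exact hasDerivWithinAt_rotating₂ (hu0 t ht) (hu1 t ht) (hs' t ht) (hc' t ht) (hψ1 t ht)
        (hA t ht) (hB t ht) (hμ0 t ht) (hμ1 t ht)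
  -- The fourth derivatives are `Ξ₂ + ū₁ R₂ S M (φ'', θ'')`. The attitude law makes the last term
  -- equal to the reference jet minus `Ξ₂` plus the linear feedback.
  have hfour : ∀ t ∈ J, FX 4 t = D 4 o.x t + ux K q o d t
      ∧ FY 4 t = D 4 o.y t + uy K q o d t := fun t ht => by
    have hdec := decoupling_mulVec_u₂₃ (hcos t ht).1 (hcos t ht).2 (hu t ht)
    have e : u₂₃ g K q o d t = ![D 2 q.φ t, D 2 q.θ t] := by
      ext k
      fin_cases k
      · exact (hq.eq_φ t (hJ.subset ht)).symm
      · exact (hq.eq_θ t (hJ.subset ht)).symm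
    rw [e] at hdec
    constructor
    · have hF : FX 4 t = (Ξ₂ g K q o d t
          + (ubar g K q o d t • (R₂ (q.ψ t) * S * M q t)) *ᵥ ![D 2 q.φ t, D 2 q.θ t]) 0 := by
        simp only [hFX, accelerationChain, Ξ₂, Ξ₁', hμ, hν, Pi.add_apply, mulVec_apply_two,
          mul_apply_two, Matrix.add_apply, Matrix.smul_apply, R₂', R₂'', pow_two (R₂ _)]
        simp [R₂, S, rates, tanVec]
        ring
      rw [hF, hdec]
      simp only [Pi.add_apply, Pi.sub_apply, Matrix.cons_val_zero]
      ring
    · have hF : FY 4 t = (Ξ₂ g K q o d t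
          + (ubar g K q o d t • (R₂ (q.ψ t) * S * M q t)) *ᵥ ![D 2 q.φ t, D 2 q.θ t]) 1 := by
        simp only [hFY, accelerationChain, Ξ₂, Ξ₁', hμ, hν, Pi.add_apply, mulVec_apply_two,
          mul_apply_two, Matrix.add_apply, Matrix.smul_apply, R₂', R₂'', pow_two (R₂ _)]
        simp [R₂, S, rates, tanVec]
        ring
      rw [hF, hdec]
      simp only [Pi.add_apply, Pi.sub_apply, Matrix.cons_val_zero, Matrix.cons_val_one]
      ring
  constructor
  · have hch : ∀ j < 4, ∀ t ∈ J, HasDerivWithinAt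
        ((fun j t => FX j t - D j o.x t - if j = 0 then d 0 else 0) j)
        ((fun j t => FX j t - D j o.x t - if j = 0 then d 0 else 0) (j + 1) t) (Ici 0) t :=
      fun j hj t ht => (((hx j hj t ht).sub
        (hox.hasDerivWithinAt hj (hJ.subset ht))).sub_const _).congr_deriv (by simp)
    have h0 : ex q o d = (fun j t => FX j t - D j o.x t - if j = 0 then d 0 else 0) 0 := by
      ext t; simp [ex, D_zero, hFX, accelerationChain]
    refine fun t ht => ⟨fun j hj => hasDerivWithinAt_D_of_chain hJ h0 hch hj ht, ?_, ?_⟩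
    · rw [D_eqOn_of_chain hJ h0 hch 4 le_rfl ht]
      simp [(hfour t ht).1]
    · rw [D_eqOn_of_chain hJ h0 hch 2 (by norm_num) ht]
      simp [hFX, accelerationChain]
  · have hch : ∀ j < 4, ∀ t ∈ J, HasDerivWithinAt
        ((fun j t => FY j t - D j o.y t - if j = 0 then d 1 else 0) j)
        ((fun j t => FY j t - D j o.y t - if j = 0 then d 1 else 0) (j + 1) t) (Ici 0) t :=
      fun j hj t ht => (((hy j hj t ht).sub
        (hoy.hasDerivWithinAt hj (hJ.subset ht))).sub_const _).congr_deriv (by simp)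
    have h0 : ey q o d = (fun j t => FY j t - D j o.y t - if j = 0 then d 1 else 0) 0 := by
      ext t; simp [ey, D_zero, hFY, accelerationChain]
    refine fun t ht => ⟨fun j hj => hasDerivWithinAt_D_of_chain hJ h0 hch hj ht, ?_, ?_⟩
    · rw [D_eqOn_of_chain hJ h0 hch 4 le_rfl ht]
      simp [(hfour t ht).2]
    · rw [D_eqOn_of_chain hJ h0 hch 2 (by norm_num) ht]
      simp [hFY, accelerationChain]

end FeedbackLinearization

/-! ### Linear error decay and avoidance of the attitude singularity. -/

section ClosedLoop

lemma expDecayOn_error {J : Set ℝ} (hJ : IsInitialInterval J) {k₁ k₂ k₃ k₄ : ℝ}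
    (hk : ExpStable k₁ k₂ k₃ k₄) {e : ℝ → ℝ}
    (he : ∀ j < 4, ∀ t ∈ J, HasDerivWithinAt (D j e) (D (j + 1) e t) (Ici 0) t)
    (h4 : ∀ t ∈ J, D 4 e t = -k₁ * e t - k₂ * D 1 e t - k₃ * D 2 e t - k₄ * D 3 e t) :
    ∀ j ≤ 4, ExpDecayOn J (D j e) := by
  refine expDecayOn_of_stable hJ 4 (fun | 0 => k₁ | 1 => k₂ | 2 => k₃ | _ => k₄)
    (fun z hz => hk z ?_) he (expDecayOn_zero.congr fun t ht => ?_)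
  · rw [← hz]
    simp [Finset.sum_range_succ]
    ring
  · simp [Finset.sum_range_succ, h4 t ht, D_zero]

/-- The altitude observer is smooth enough for the local tracking law. -/
lemma timesDiff_four_z {n : ℕ} {G : SimpleGraph (Fin n)} [DecidableRel G.Adj]
    {informed : Finset (Fin n)} {K : Gains} {L : Leader} {o : Fin n → Obs}
    (ho : IsObserver G informed K L o) (i : Fin n) : TimesDiff 4 (o i).z := by
  have hz0 : ∀ t ∈ Ici (0 : ℝ), HasDerivWithinAt (o i).z (D 1 (o i).z t) (Ici 0) t :=
    fun t ht => (ho.diff_z i).hasDerivWithinAt_self ht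
  have hz1 : ∀ t ∈ Ici (0 : ℝ), HasDerivWithinAt (D 1 (o i).z) (D 2 (o i).z t) (Ici 0) t :=
    fun t ht => (ho.diff_z i).hasDerivWithinAt (j := 1) (by norm_num) ht
  have ha0 : ∀ t ∈ Ici (0 : ℝ), HasDerivWithinAt (o i).za (D 1 (o i).za t) (Ici 0) t :=
    fun t ht => (ho.diff_za i).hasDerivWithinAt_self ht
  have ha1 : ∀ t ∈ Ici (0 : ℝ), HasDerivWithinAt (D 1 (o i).za) (D 2 (o i).za t) (Ici 0) t :=
    fun t ht => (ho.diff_za i).hasDerivWithinAt (j := 1) (by norm_num) ht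
  have hs : ∀ t ∈ Ici (0 : ℝ), HasDerivWithinAt
      (fun t => D 1 (o i).z t + K.h₂ * ((o i).z t - (o i).za t))
      (D 2 (o i).z t + K.h₂ * (D 1 (o i).z t - D 1 (o i).za t)) (Ici 0) t :=
    fun t ht => (hz1 t ht).add (((hz0 t ht).sub (ha0 t ht)).const_mul K.h₂)
  -- Bootstrapping: the observer equation is differentiated, and the resulting formula for `D 3` is
  -- differentiated again in the last case. Only existence matters, so the value of the derivative
  -- is left to unification.
  have hz2 : ∀ t ∈ Ici (0 : ℝ), HasDerivWithinAt (D 2 (o i).z) _ (Ici 0) t := fun t ht =>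
    hasDerivWithinAt_congr_on isInitialInterval_Ici ht
      (((HasDerivWithinAt.tanh (hs t ht)).const_mul (-K.h₁)).sub
        ((HasDerivWithinAt.tanh (hz1 t ht)).const_mul K.h₃)) fun s hs => ho.eq_z i s hs
  intro j hj
  interval_cases j
  · exact fun t ht => ((ho.diff_z i).hasDerivWithinAt (by norm_num) ht).differentiableWithinAt
  · exact fun t ht => (hz1 t ht).differentiableWithinAt
  · exact fun t ht => (hz2 t ht).differentiableWithinAt
  · intro t ht
    have hd := hasDerivWithinAt_congr_on (h := D 3 (o i).z) isInitialInterval_Ici ht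
      ((((((HasDerivWithinAt.tanh (hs t ht)).pow 2).const_sub 1).mul
          ((hz2 t ht).add (((hz1 t ht).sub (ha1 t ht)).const_mul K.h₂))).const_mul (-K.h₁)).sub
        (((((HasDerivWithinAt.tanh (hz1 t ht)).pow 2).const_sub 1).mul (hz2 t ht)).const_mul K.h₃))
      fun s hs => D_succ_eq hs (hz2 s hs)
    exact hd.differentiableWithinAt

variable {g : ℝ} {K : Gains} {L : Leader} {q : Quad} {o : Obs} {d : Fin 3 → ℝ}

/-- From `tan² cos² = 1 - cos²` and `m² tan² ≤ N²` follows `m² (1 - cos²) ≤ N² cos²`. The auxiliary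
`x` allows for `tan φ / cos θ`, which dominates `tan φ`. -/
lemma sq_cos_lower_bound {m N θ x : ℝ} (hcos : Real.cos θ ≠ 0) (hm : 0 < m)
    (h : m * |x| ≤ N) (hx : |Real.tan θ| ≤ |x|) :
    m ^ 2 / (N ^ 2 + m ^ 2) ≤ Real.cos θ ^ 2 := by
  have h1 : (m * |Real.tan θ|) ^ 2 ≤ N ^ 2 :=
    pow_le_pow_left₀ (by positivity) ((mul_le_mul_of_nonneg_left hx hm.le).trans h) 2
  rw [mul_pow, sq_abs] at h1
  have h2 : Real.tan θ ^ 2 * Real.cos θ ^ 2 = 1 - Real.cos θ ^ 2 := by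
    rw [← mul_pow, Real.tan_mul_cos hcos, Real.sin_sq]
  rw [div_le_iff₀ (by positivity)]
  nlinarith [mul_le_mul_of_nonneg_right h1 (sq_nonneg (Real.cos θ))]

/-- The attitude singularity is never reached. -/
lemma cos_ne_zero_of_isControlled (hK : K.Admissible g L) (hq : IsControlled g K q o d)
    (hox : TimesDiff 4 o.x) (hoy : TimesDiff 4 o.y) (hoz : TimesDiff 4 o.z)
    (hkz : ∀ t, 0 ≤ t → K.kz₁ + K.kz₃ < g - |D 2 o.z t|)
    (hφ : Real.cos (q.φ 0) ≠ 0) (hθ : Real.cos (q.θ 0) ≠ 0) {t : ℝ} (ht : t ∈ Ici (0 : ℝ)) :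
    Real.cos (q.θ t) ≠ 0 ∧ Real.cos (q.φ t) ≠ 0 := by
  set f : ℝ → ℝ := fun t => Real.cos (q.θ t) * Real.cos (q.φ t) with hf
  have hfc : ContinuousOn f (Ici 0) := fun t ht =>
    (hq.diff_θ.hasDerivWithinAt_self ht).cos.continuousWithinAt.mul
      (hq.diff_φ.hasDerivWithinAt_self ht).cos.continuousWithinAt
  suffices h : f t ≠ 0 from ⟨left_ne_zero_of_mul h, right_ne_zero_of_mul h⟩
  intro hft
  set bad : Set ℝ := Ici 0 ∩ f ⁻¹' {0} with hbad
  have hclosed : IsClosed bad := hfc.preimage_isClosed_of_isClosed isClosed_Ici isClosed_singleton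
  have hbdd : BddBelow bad := ⟨0, fun s hs => hs.1⟩
  obtain ⟨hT0, hTf⟩ := hclosed.csInf_mem ⟨t, ht, hft⟩ hbdd
  -- `T` is the first time at which `cos θ cos φ` vanishes; the set is closed, so the value at `T`
  -- is `0`, and the initial attitude forces `T > 0`.
  set T := sInf bad with hT
  have hTpos : 0 < T := by
    refine lt_of_le_of_ne hT0 fun h0 => ?_
    rw [← h0] at hTf
    exact mul_ne_zero hθ hφ hTf
  have hJ := isInitialInterval_Ico hTpos
  have hcos : ∀ s ∈ Ico 0 T, Real.cos (q.θ s) ≠ 0 ∧ Real.cos (q.φ s) ≠ 0 := fun s hs => by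
    have h : f s ≠ 0 := fun h => absurd (csInf_le hbdd ⟨hs.1, h⟩) (not_le.2 hs.2)
    exact ⟨left_ne_zero_of_mul h, right_ne_zero_of_mul h⟩
  have hupos : ∀ s ∈ Ici (0 : ℝ), 0 < ubar g K q o d s := fun s hs =>
    ubar_pos hK.kz₁_pos hK.kz₃_pos (hkz s hs)
  obtain ⟨hX, hY⟩ := horizontal_error_dynamics hJ hq hox hoy hoz hcos
    fun s hs => (hupos s hs.1).ne'
  obtain ⟨C₁, hC₁⟩ := (expDecayOn_error hJ hK.stable_x (fun j hj s hs => (hX s hs).1 j hj)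
    (fun s hs => (hX s hs).2.1) 2 (by norm_num)).bounded hJ.subset
  obtain ⟨C₂, hC₂⟩ := (expDecayOn_error hJ hK.stable_y (fun j hj s hs => (hY s hs).1 j hj)
    (fun s hs => (hY s hs).2.1) 2 (by norm_num)).bounded hJ.subset
  -- The reference accelerations need no global bound: continuity on the compact `[0, T]` suffices,
  -- and likewise for the minimum of `ū₁`.
  obtain ⟨C₃, hC₃⟩ := (isCompact_Icc (a := 0) (b := T)).exists_bound_of_continuousOn
    (f := D 2 o.x) fun s hs =>
      ((hox 2 (by norm_num)).continuousOn s hs.1).mono Icc_subset_Ici_self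
  obtain ⟨C₄, hC₄⟩ := (isCompact_Icc (a := 0) (b := T)).exists_bound_of_continuousOn
    (f := D 2 o.y) fun s hs =>
      ((hoy 2 (by norm_num)).continuousOn s hs.1).mono Icc_subset_Ici_self
  obtain ⟨t₀, ht₀, hmin⟩ := (isCompact_Icc (a := 0) (b := T)).exists_isMinOn
    (nonempty_Icc.2 hTpos.le)
    (f := ubar g K q o d) fun s hs =>
      (hasDerivWithinAt_ubar hq.diff_z hoz hs.1).continuousWithinAt.mono Icc_subset_Ici_self
  set m := ubar g K q o d t₀ with hm
  have hmpos : 0 < m := hupos t₀ ht₀.1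
  set N := (C₁ + C₃) + (C₂ + C₄) with hN
  set κ := m ^ 2 / (N ^ 2 + m ^ 2) with hκ
  have hκpos : 0 < κ := by positivity
  have hlow : ∀ s ∈ Ico 0 T, κ * κ ≤ f s ^ 2 := fun s hs => by
    obtain ⟨hcθ, hcφ⟩ := hcos s hs
    have hsIcc : s ∈ Icc 0 T := Ico_subset_Icc_self hs
    have hum : m ≤ ubar g K q o d s := hmin hsIcc
    have hx := (hX s hs).2.2
    have hy := (hY s hs).2.2
    set a := ubar g K q o d s
    set X := D 2 (ex q o d) s + D 2 o.x s
    set Y := D 2 (ey q o d) s + D 2 o.y s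
    have hXb : |X| ≤ C₁ + C₃ := (abs_add_le _ _).trans (add_le_add (hC₁ s hs) (hC₃ s hsIcc))
    have hYb : |Y| ≤ C₂ + C₄ := (abs_add_le _ _).trans (add_le_add (hC₂ s hs) (hC₄ s hsIcc))
    have hcs := Real.sin_sq_add_cos_sq (q.ψ s)
    have hbound : ∀ c₁ c₂ z : ℝ, |c₁| ≤ 1 → |c₂| ≤ 1 → a * z = c₁ * X + c₂ * Y →
        m * |z| ≤ N := fun c₁ c₂ z h₁ h₂ h => by
      calc m * |z| ≤ a * |z| := mul_le_mul_of_nonneg_right hum (abs_nonneg z)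
        _ = |c₁ * X + c₂ * Y| := by rw [← h, abs_mul, abs_of_pos (hmpos.trans_le hum)]
        _ ≤ |c₁| * |X| + |c₂| * |Y| := by rw [← abs_mul, ← abs_mul]; exact abs_add_le _ _
        _ ≤ 1 * |X| + 1 * |Y| := by gcongr
        _ ≤ N := by rw [one_mul, one_mul]; exact add_le_add hXb hYb
    -- The matrix `R₂ S` is symmetric and orthogonal, so applying it to the horizontal acceleration
    -- `(X, Y)` recovers `ū₁ tanVec` componentwise.
    have hA := hbound (Real.cos (q.ψ s)) (Real.sin (q.ψ s)) (tanVec q s 0) (Real.abs_cos_le_one _)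
      (Real.abs_sin_le_one _) (by rw [hx, hy]; linear_combination (-a * tanVec q s 0) * hcs)
    have hB := hbound (Real.sin (q.ψ s)) (-Real.cos (q.ψ s)) (tanVec q s 1)
      (Real.abs_sin_le_one _) (by rw [abs_neg]; exact Real.abs_cos_le_one _)
      (by rw [hx, hy]; linear_combination (-a * tanVec q s 1) * hcs)
    have h1 : κ ≤ Real.cos (q.θ s) ^ 2 := sq_cos_lower_bound hcθ hmpos hA le_rfl
    have h2 : κ ≤ Real.cos (q.φ s) ^ 2 := by
      refine sq_cos_lower_bound hcφ hmpos hB ?_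
      change |Real.tan (q.φ s)| ≤ |Real.tan (q.φ s) / Real.cos (q.θ s)|
      rw [abs_div]
      exact le_div_self (abs_nonneg _) (abs_pos.2 hcθ) (Real.abs_cos_le_one _)
    simp only [hf, mul_pow]
    exact mul_le_mul h1 h2 hκpos.le (sq_nonneg _)
  -- `κ` does not depend on `s`, so the bound survives the limit `s → T` by continuity of `f` and
  -- contradicts `f T = 0`.
  have hTlim : κ * κ ≤ f T ^ 2 := by
    refine ContinuousWithinAt.closure_le (s := Ico 0 T) (f := fun _ => κ * κ)
      (g := fun s => f s ^ 2) ?_ continuousWithinAt_const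
      (((hfc T hT0).mono Ico_subset_Ici_self).pow 2) hlow
    rw [closure_Ico hTpos.ne]
    exact right_mem_Icc.2 hTpos.le
  rw [show f T = 0 from hTf] at hTlim
  nlinarith [mul_pos hκpos hκpos]

end ClosedLoop
end QuadrotorFormation

/-! ### The main theorem. -/

open QuadrotorFormation in
theorem theorem2 {n : ℕ}
    -- the leader, with four times differentiable horizontal position, bounded derivatives
    -- and constant altitude
    (L : Leader) (hLx : SmoothBounded L.x) (hLy : SmoothBounded L.y)
    -- the undirected connected interaction graph, with at least one informed follower
    (G : SimpleGraph (Fin n)) [DecidableRel G.Adj] (hG : G.Connected)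
    (informed : Finset (Fin n)) (hinf : informed.Nonempty)
    -- the gravitational acceleration and the gains
    (g : ℝ) (K : Gains) (hK : K.Admissible g L)
    -- the desired displacements from the leader
    (Δ : Fin n → Fin 3 → ℝ)
    -- the distributed observers
    (o : Fin n → Obs) (ho : IsObserver G informed K L o)
    -- the thrust gains are small enough for the reference altitude accelerations
    (hkz : ∀ i t, 0 ≤ t → K.kz₁ + K.kz₃ < g - |D 2 (o i).z t|)
    -- the quad-rotors under the local tracking laws, starting with roll and pitch in `(-π/2, π/2)`
    (q : Fin n → Quad) (hq : ∀ i, IsControlled g K (q i) (o i) (Δ i))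
    (hφ : ∀ i, (q i).φ 0 ∈ Set.Ioo (-(Real.pi / 2)) (Real.pi / 2))
    (hθ : ∀ i, (q i).θ 0 ∈ Set.Ioo (-(Real.pi / 2)) (Real.pi / 2)) :
    ∀ i, Filter.Tendsto
      (fun t => ![(q i).x t - L.x t, (q i).y t - L.y t, (q i).z t - L.z])
      Filter.atTop (nhds (Δ i)) := by
  intro i
  have hoz := timesDiff_four_z ho i
  -- Once the singularity is excluded for all times, the linearization applies again with `J = [0,
  -- ∞)` and yields asymptotic statements.
  have hcos : ∀ t ∈ Set.Ici (0 : ℝ), Real.cos ((q i).θ t) ≠ 0 ∧ Real.cos ((q i).φ t) ≠ 0 :=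
    fun t ht => cos_ne_zero_of_isControlled hK (hq i) (ho.eq_x i).1 (ho.eq_y i).1 hoz (hkz i)
      (Real.cos_pos_of_mem_Ioo (hφ i)).ne' (Real.cos_pos_of_mem_Ioo (hθ i)).ne' ht
  obtain ⟨hX, hY⟩ := horizontal_error_dynamics isInitialInterval_Ici (hq i) (ho.eq_x i).1
    (ho.eq_y i).1 hoz hcos
    fun s hs => (ubar_pos hK.kz₁_pos hK.kz₃_pos (hkz i s hs)).ne'
  have hex := (expDecayOn_error isInitialInterval_Ici hK.stable_x
    (fun j hj s hs => (hX s hs).1 j hj) (fun s hs => (hX s hs).2.1) 0 (by norm_num)).tendsto_zero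
  have hey := (expDecayOn_error isInitialInterval_Ici hK.stable_y
    (fun j hj s hs => (hY s hs).1 j hj) (fun s hs => (hY s hs).2.1) 0 (by norm_num)).tendsto_zero
  rw [D_zero] at hex hey
  have hox := (expDecayOn_horizontal hG hinf hK ho.eq_x hLx.1 hK.g₅x_ge i).tendsto_zero
  have hoy := (expDecayOn_horizontal hG hinf hK ho.eq_y hLy.1 hK.g₅y_ge i).tendsto_zero
  have hozL := tendsto_altitude_observer hG hinf hK ho i
  have hez0 : ∀ t ∈ Set.Ici (0 : ℝ), HasDerivWithinAt (ez (q i) (o i) (Δ i))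
      (D 1 (ez (q i) (o i) (Δ i)) t) (Set.Ici 0) t := fun t ht => by
    have := hasDerivWithinAt_ez (d := Δ i) (hq i).diff_z (ho.diff_z i) (j := 0) (by norm_num) ht
    rwa [D_zero] at this
  have hez1 : ∀ t ∈ Set.Ici (0 : ℝ), HasDerivWithinAt (D 1 (ez (q i) (o i) (Δ i)))
      (-K.kz₁ * Real.tanh (D 1 (ez (q i) (o i) (Δ i)) t + K.kz₂ * ez (q i) (o i) (Δ i) t)
        - K.kz₃ * Real.tanh (D 1 (ez (q i) (o i) (Δ i)) t)) (Set.Ici 0) t := fun t ht =>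
    (hasDerivWithinAt_ez (hq i).diff_z (ho.diff_z i) (j := 1) (by norm_num) ht).congr_deriv
      (D_two_ez_eq (hq i) (ho.diff_z i) ht (hcos t ht).1 (hcos t ht).2)
  -- The altitude error is the saturated system with zero input; `(s - p) / kz₂` then recovers the
  -- error itself.
  obtain ⟨hp, hs⟩ := tendsto_zero_of_saturated (p := D 1 (ez (q i) (o i) (Δ i)))
    (s := fun t => D 1 (ez (q i) (o i) (Δ i)) t + K.kz₂ * ez (q i) (o i) (Δ i) t)
    (η := fun _ => 0) hK.kz₁_pos hK.kz₃_pos hK.kz₂_pos hez1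
    (fun t ht => ((hez1 t ht).add ((hez0 t ht).const_mul K.kz₂)).congr_deriv (by ring))
    expDecayOn_zero
  have hez : Filter.Tendsto (ez (q i) (o i) (Δ i)) Filter.atTop (nhds 0) := by
    have h := (hs.sub hp).div_const K.kz₂
    rw [sub_zero, zero_div] at h
    refine h.congr fun t => ?_
    have := hK.kz₂_pos.ne'
    field_simp
    ring
  rw [tendsto_pi_nhds]
  intro k
  fin_cases k
  · have h := (hex.add hox).add_const (Δ i 0)
    rw [add_zero, zero_add] at h
    exact h.congr fun t => by simp [ex]; ring
  · have h := (hey.add hoy).add_const (Δ i 1)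
    rw [add_zero, zero_add] at h
    exact h.congr fun t => by simp [ey]; ring
  · have h := (hez.add hozL).add_const (Δ i 2)
    rw [add_zero, zero_add] at h
    exact h.congr fun t => by simp [ez]; ring
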